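/- **Setting.** Let $\mathbb T^2=\mathbb R^2/2\pi\mathbb Z^2$, $\nu_1,\nu_2>0$, $g\in\mathbb R\setminus\{0\}$. Let $H$ be the space of pairs $U=(w,\theta)\in L^2(\mathbb T^2)^2$ with $\int w\,dx=\int\theta\,dx=0$, with the norm $\|U\|=\big(\tfrac{\nu_1\nu_2}{g^2}\|w\|_{L^2}^2+\|\theta\|_{L^2}^2\big)^{1/2}$. Let $\mathcal Z\subset\mathbb Z^2\setminus\{0\}$ be finite, let $\alpha_k^m\in\mathbb R$ for $k\in\mathcal Z$, $m\in\{0,1\}$, and put $d=2|\mathcal Z|$. On a probability space let $W=(W^{k,m})_{k\in\mathcal Z,m\in\{0,1\}}$ be a standard $d$-dimensional Brownian motion and let $S$ be an independent pure jump (driftless) subordinator whose Lévy measure $\nu_S$ on $(0,\infty)$ satisfies $\int_0^\infty(1\wedge r)\,\nu_S(dr)<\infty$. Consider the stochastic Boussinesq system in vorticity form, driven by the subordinated Brownian motion $W_{S_t}$, $$dw+\big((u\cdot\nabla)w-\nu_1\Delta w\big)dt=g\,\partial_{x_1}\theta\,dt,$$ $$d\theta+\big((u\cdot\nabla)\theta-\nu_2\Delta\theta\big)dt=\sum_{k\in\mathcal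 Z}\big(\alpha_k^0\cos(k\cdot x)\,dW^{k,0}_{S_t}+\alpha_k^1\sin(k\cdot x)\,dW^{k,1}_{S_t}\big),$$ where $u$ is the mean-zero velocity field with $\nabla\cdot u=0$ and $\partial_{x_1}u_2-\partial_{x_2}u_1=w$ (Biot–Savart law). A solution started at $U_0\in H$ is an $H$-valued process $U=(w,\theta)$ such that almost surely the path of $U$ is càdlàg in $H$, belongs to $L^2(0,T;H^1)$ for every $T>0$, and satisfies the equations integrated in time from the initial value $U_0$, weakly against all test functions in $C^\infty(\mathbb T^2)$. Write $U(t,U_0)$ for the solution started at $U_0$, and $P_t(U_0,A)=\mathbb P(U(t,U_0)\in A)$ for Borel sets $A\subseteq H$. **Proposition (weak irreducibility).** For any $\mathcal C,\gamma>0$ there exists $T=T(\mathcal C,\gamma)>0$ such that $$\inf_{\|U_0\|\le\mathcal C}P_T(U_0,\mathcal B_\gamma)>0,\qquad \mathcal B_\gamma=\{U\in H:\|U\|\le\gamma\}.$$ The infimum is taken over all $U_0\in H$ with $\|U_0\|\le\mathcal C$ and over all solutions started at $U_0$. -/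

import Mathlib

open MeasureTheory ProbabilityTheory Filter Topology Set
open scoped NNReal ENNReal

noncomputable section

namespace Boussinesq

/-! ### The torus, test functions and the phase space -/

instance factTwoPiPos : Fact ((0 : ℝ) < 2 * Real.pi) := ⟨Real.two_pi_pos⟩

/-- The torus `ℝ² / 2πℤ²`; its `volume` is Lebesgue measure `dx`, of total mass `(2π)²`. -/
abbrev Torus : Type := Fin 2 → AddCircle (2 * Real.pi)

/-- The real space `L²(𝕋²)`. -/
abbrev L2 : Type := Lp ℝ 2 (volume : Measure Torus)

/-- `φ` is `C^∞` on the torus: its `2π`-periodic lift to `ℝ²` is `C^∞`. -/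
def IsSmooth (φ : Torus → ℝ) : Prop :=
  ContDiff ℝ ((⊤ : ℕ∞) : WithTop ℕ∞) (fun x : Fin 2 → ℝ => φ (fun i => (x i : AddCircle (2 * Real.pi))))

/-- The partial derivative `∂_j φ` of a smooth function on the torus. -/
def partialD (j : Fin 2) (φ : Torus → ℝ) (x : Torus) : ℝ :=
  deriv (fun s : ℝ => φ (x + Pi.single j (s : AddCircle (2 * Real.pi)))) 0

/-- The Laplacian `Δφ = ∂₁∂₁φ + ∂₂∂₂φ`. -/
def laplacian (φ : Torus → ℝ) (x : Torus) : ℝ :=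
  ∑ j : Fin 2, partialD j (partialD j φ) x

/-- The trigonometric functions `cos (k · x)` (for `m = 0`) and `sin (k · x)` (for `m = 1`), as the
real and imaginary parts of `e^{i k · x} = e^{i k₁ x₁} e^{i k₂ x₂}`. -/
def trig (k : Fin 2 → ℤ) (m : Fin 2) (x : Torus) : ℝ :=
  if m = 0 then (∏ j : Fin 2, fourier (k j) (x j)).re else (∏ j : Fin 2, fourier (k j) (x j)).im

/-- The phase space `H` of pairs `U = (w, θ)` of square integrable functions with mean zero.
It carries the `L²` topology; the norm of `U` used below is `energyNorm`. -/
def H : Submodule ℝ (L2 × L2) where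
  carrier := {U | ∫ x, U.1 x = 0 ∧ ∫ x, U.2 x = 0}
  zero_mem' := by
    constructor
    · exact (integral_congr_ae (Lp.coeFn_zero ℝ 2 (volume : Measure Torus))).trans (by simp)
    · exact (integral_congr_ae (Lp.coeFn_zero ℝ 2 (volume : Measure Torus))).trans (by simp)
  add_mem' := by
    intro U V hU hV
    have key : ∀ f h : L2, ∫ x, f x = 0 → ∫ x, h x = 0 → ∫ x, (f + h : L2) x = 0 := by
      intro f h hf hh
      rw [integral_congr_ae (Lp.coeFn_add f h)]
      have := integral_add ((Lp.memLp f).integrable (by norm_num))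
        ((Lp.memLp h).integrable (by norm_num))
      simp only [Pi.add_apply]
      rw [this, hf, hh, add_zero]
    exact ⟨key _ _ hU.1 hV.1, key _ _ hU.2 hV.2⟩
  smul_mem' := by
    intro c U hU
    have key : ∀ f : L2, ∫ x, f x = 0 → ∫ x, (c • f : L2) x = 0 := by
      intro f hf
      rw [integral_congr_ae (Lp.coeFn_smul c f)]
      simp only [Pi.smul_apply]
      rw [integral_smul, hf, smul_zero]
    exact ⟨key _ hU.1, key _ hU.2⟩

/-- The vorticity component `w` of `U = (w, θ)`. -/
def vort (U : H) : L2 := U.1.1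

/-- The temperature component `θ` of `U = (w, θ)`. -/
def temp (U : H) : L2 := U.1.2

/-- The norm `‖U‖ = (ν₁ ν₂ g⁻² ‖w‖² + ‖θ‖²)^{1/2}` of `H`. -/
def energyNorm (ν₁ ν₂ g : ℝ) (U : H) : ℝ :=
  Real.sqrt (ν₁ * ν₂ / g ^ 2 * ‖vort U‖ ^ 2 + ‖temp U‖ ^ 2)

/-- The closed ball of radius `γ` about `0` in `H`. -/
def closedBallH (ν₁ ν₂ g γ : ℝ) : Set H := {U | energyNorm ν₁ ν₂ g U ≤ γ}

/-- `f'` is the weak (distributional) partial derivative `∂_j f` on the torus. -/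
def HasWeakPartial (j : Fin 2) (f f' : L2) : Prop :=
  ∀ φ : Torus → ℝ, IsSmooth φ → ∫ x, f x * partialD j φ x = -∫ x, f' x * φ x

/-- `u = 𝒦 * w` is the velocity field recovered from the vorticity `w` by the Biot-Savart law: the
(unique) mean-zero field with `∇ · u = 0` and `∂₁ u₂ - ∂₂ u₁ = w` weakly. -/
structure IsBiotSavart (w : L2) (u : Fin 2 → L2) : Prop where
  mean_zero : ∀ j, ∫ x, u j x = 0
  div_free : ∀ φ : Torus → ℝ, IsSmooth φ →
    ∫ x, (u 0 x * partialD 0 φ x + u 1 x * partialD 1 φ x) = 0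
  curl_eq : ∀ φ : Torus → ℝ, IsSmooth φ →
    ∫ x, (u 0 x * partialD 1 φ x - u 1 x * partialD 0 φ x) = ∫ x, w x * φ x

/-! ### The stochastic Boussinesq system in vorticity form -/

/-- The drift `-(u · ∇) w + ν₁ Δ w + g ∂₁ θ` of the vorticity, tested against `φ`. -/
def vortDrift (ν₁ g : ℝ) (U : H) (u : Fin 2 → L2) (φ : Torus → ℝ) : ℝ :=
  (∫ x, vort U x * (u 0 x * partialD 0 φ x + u 1 x * partialD 1 φ x))
    + ν₁ * (∫ x, vort U x * laplacian φ x) - g * ∫ x, temp U x * partialD 0 φ x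

/-- The drift `-(u · ∇) θ + ν₂ Δ θ` of the temperature, tested against `φ`. -/
def tempDrift (ν₂ : ℝ) (U : H) (u : Fin 2 → L2) (φ : Torus → ℝ) : ℝ :=
  (∫ x, temp U x * (u 0 x * partialD 0 φ x + u 1 x * partialD 1 φ x))
    + ν₂ * ∫ x, temp U x * laplacian φ x

/-- The noise coordinates: the pairs `(k, m)` with `k ∈ 𝒵` and `m ∈ {0, 1}`. -/
abbrev NoiseIndex (Z : Finset (Fin 2 → ℤ)) : Type := {k // k ∈ Z} × Fin 2

/-- The noise `σ_θ ℓ = ∑ α_k^m σ_k^m ℓ^{k,m}`, whose only nonzero component is the temperature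
component, tested against `φ`. -/
def forcing (Z : Finset (Fin 2 → ℤ)) (α : NoiseIndex Z → ℝ) (l : NoiseIndex Z → ℝ)
    (φ : Torus → ℝ) : ℝ :=
  ∑ i : NoiseIndex Z, α i * (∫ x, trig i.1 i.2 x * φ x) * l i

/-- `U : [0, ∞) → H` is a solution, with initial value `U₀`, of
`dU = (-A U - B(U) + G U) dt + σ_θ dL` for a given path `L` of the noise. It is càdlàg in `H`,
belongs to `L²(0, T; H¹)` for every `T`, and solves the time-integrated equation weakly. -/
structure IsPathSolution (ν₁ ν₂ g : ℝ) (Z : Finset (Fin 2 → ℤ)) (α : NoiseIndex Z → ℝ)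
    (L : ℝ≥0 → NoiseIndex Z → ℝ) (U₀ : H) (U : ℝ≥0 → H) : Prop where
  right_cont : ∀ t, ContinuousWithinAt U (Ici t) t
  left_lim : ∀ t, ∃ V : H, Tendsto U (𝓝[<] t) (𝓝 V)
  sobolev : ∀ T : ℝ≥0, ∃ Dw Dθ : Fin 2 → ℝ → L2,
    (∀ j, MemLp (Dw j) 2 (volume.restrict (Icc (0 : ℝ) T)) ∧
      MemLp (Dθ j) 2 (volume.restrict (Icc (0 : ℝ) T))) ∧
    ∀ᵐ s ∂(volume.restrict (Icc (0 : ℝ) T)), ∀ j,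
      HasWeakPartial j (vort (U s.toNNReal)) (Dw j s) ∧
      HasWeakPartial j (temp (U s.toNNReal)) (Dθ j s)
  equation : ∃ u : ℝ≥0 → Fin 2 → L2, (∀ t, IsBiotSavart (vort (U t)) (u t)) ∧
    ∀ (t : ℝ≥0) (φ : Torus → ℝ), IsSmooth φ →
      (∫ x, vort (U t) x * φ x = (∫ x, vort U₀ x * φ x)
        + ∫ s in (0 : ℝ)..t, vortDrift ν₁ g (U s.toNNReal) (u s.toNNReal) φ) ∧
      (∫ x, temp (U t) x * φ x = (∫ x, temp U₀ x * φ x)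
        + (∫ s in (0 : ℝ)..t, tempDrift ν₂ (U s.toNNReal) (u s.toNNReal) φ)
        + forcing Z α (L t) φ)

/-! ### The noise -/

/-- `W` is a standard Brownian motion in `ℝ^ι`: its coordinates are independent standard real
Brownian motions. -/
structure IsBrownianFamily {Ω ι : Type*} [MeasurableSpace Ω] (W : ι → ℝ≥0 → Ω → ℝ)
    (P : Measure Ω) : Prop where
  brownian : ∀ i, IsBrownianReal (W i) P
  indep : iIndepFun (fun i ω (t : ℝ≥0) => W i t ω) P

/-- `S` is a pure jump (driftless) subordinator with Lévy measure `νS` on `(0, ∞)`: almost surely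
it starts at `0` and is increasing and càdlàg, it has independent increments, and
`E exp (-q (S_t - S_s)) = exp (-(t - s) ∫_{(0, ∞)} (1 - e^{-q r}) νS(dr))`. -/
structure IsPureJumpSubordinator {Ω : Type*} [MeasurableSpace Ω] (S : ℝ≥0 → Ω → ℝ≥0)
    (νS : Measure ℝ) (P : Measure Ω) : Prop where
  aemeasurable : ∀ t, AEMeasurable (S t) P
  start : ∀ᵐ ω ∂P, S 0 ω = 0
  mono : ∀ᵐ ω ∂P, Monotone (fun t => S t ω)
  right_cont : ∀ᵐ ω ∂P, ∀ t, ContinuousWithinAt (fun r => S r ω) (Ici t) t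
  indep : HasIndepIncrements (fun t ω => (S t ω : ℝ)) P
  laplace : ∀ s t : ℝ≥0, s ≤ t → ∀ q : ℝ, 0 ≤ q →
    ∫ ω, Real.exp (-q * ((S t ω : ℝ) - S s ω)) ∂P
      = Real.exp (-((t : ℝ) - s) * ∫ r in Ioi (0 : ℝ), (1 - Real.exp (-q * r)) ∂νS)

/-- The process `U` is a solution, started at `U₀`, of the stochastic Boussinesq system driven by
the subordinated Brownian motion `L_t = W_{S_t}`. The noise is additive, so the equation is
understood path by path, almost surely. -/
structure IsSolution {Ω : Type*} [MeasurableSpace Ω] (P : Measure Ω) (ν₁ ν₂ g : ℝ)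
    (Z : Finset (Fin 2 → ℤ)) (α : NoiseIndex Z → ℝ) (W : NoiseIndex Z → ℝ≥0 → Ω → ℝ)
    (S : ℝ≥0 → Ω → ℝ≥0) (U₀ : H) (U : ℝ≥0 → Ω → H) : Prop where
  aestronglyMeasurable : ∀ t, AEStronglyMeasurable (U t) P
  path : ∀ᵐ ω ∂P, IsPathSolution ν₁ ν₂ g Z α (fun t i => W i (S t ω) ω) U₀ (fun t => U t ω)

end Boussinesq

end

open Boussinesq

/-!
If the noise vanished, the weighted energy `‖U‖²` would decay exponentially: the advection terms drop
out, the weight `ν₁ ν₂ / g²` lets the dissipation absorb the buoyancy term `g ∂₁ θ`, and the Poincaré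
inequality turns dissipation into decay. A noise path that stays below a small `δ` up to a time `T`
changes this little: with `q = σ_θ L`, the pair `(w, θ - q)` has no jumps and solves a perturbed system
whose energy still falls below any prescribed level (`exists_decay`). As the time `T` and the size `δ`
depend only on `C` and `γ`, a single event of positive probability serves all solutions.

The energy inequality is proved for finitely many Fourier modes, whose coefficients are primitives
of right-continuous drifts. The functions `cos (k · x)`, `sin (k · x)` over all `k ∈ ℤ²` form a tight frame of
`L²` (`hasSum_trig`), so that only the convergence of partial Fourier sums is needed to let the number
of modes tend to infinity. The nonlinear term does not vanish on finitely many modes, but by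
incompressibility only the Fourier tail of the transported quantity contributes to it
(`transport_coef_sq_le`). The Biot-Savart law bounds the velocity uniformly by `‖∇w‖`
(`exists_velocity_bound`), so this contribution is at most a part of the dissipation plus a multiple of
`‖∇w‖²` times the squared tail (`energyRate_le`), whose time integral tends to zero by dominated
convergence (`tailErr_tendsto`).

The driving process `W_{S_t}` is small up to the time `T` with positive probability
(`exists_small_noise_event`): since `S` has no drift, its Laplace exponent is sublinear, so `S_T ≤ ε` has
positive probability for every `ε > 0`, while `W` is small on `[0, ε]` for `ε` small by continuity, and `W`
and `S` are independent.
-/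

noncomputable section

namespace Boussinesq

/-! ### The Fourier basis of the torus -/

/-- The character `e^{i k · x}` of the torus. -/
def torusChar (k : Fin 2 → ℤ) : C(Torus, ℂ) where
  toFun x := ∏ j : Fin 2, fourier (k j) (x j)
  continuous_toFun := by fun_prop

lemma torusChar_neg (k : Fin 2 → ℤ) (x : Torus) :
    torusChar (-k) x = (starRingEnd ℂ) (torusChar k x) := by
  simp [torusChar]

lemma torusChar_add (k l : Fin 2 → ℤ) (x : Torus) :
    torusChar (k + l) x = torusChar k x * torusChar l x := by
  simp only [torusChar, ContinuousMap.coe_mk, Pi.add_apply, fourier_add, Finset.prod_mul_distrib]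

lemma torusChar_zero (x : Torus) : torusChar 0 x = 1 := by
  simp [torusChar]

lemma norm_torusChar (k : Fin 2 → ℤ) (x : Torus) : ‖torusChar k x‖ = 1 := by
  simp only [torusChar, ContinuousMap.coe_mk, fourier_apply, norm_prod, Circle.norm_coe,
    Finset.prod_const_one]

/-- The star subalgebra of the continuous functions generated by the characters. -/
def charSubalgebra : StarSubalgebra ℂ C(Torus, ℂ) where
  toSubalgebra := Algebra.adjoin ℂ (range torusChar)
  star_mem' := by
    change Algebra.adjoin ℂ (range torusChar) ≤ star (Algebra.adjoin ℂ (range torusChar))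
    refine Algebra.adjoin_le ?_
    rintro _ ⟨n, rfl⟩
    refine Algebra.subset_adjoin ⟨-n, ?_⟩
    ext1 x
    simp only [torusChar_neg, starRingEnd_apply, ContinuousMap.star_apply]

lemma charSubalgebra_coe :
    charSubalgebra.toSubalgebra.toSubmodule = Submodule.span ℂ (range torusChar) := by
  apply Algebra.adjoin_eq_span_of_subset
  refine .trans (fun x ↦ Submonoid.closure_induction (fun _ ↦ id) ⟨0, ?_⟩ ?_)
    Submodule.subset_span
  · ext z
    exact torusChar_zero z
  · rintro _ _ _ _ ⟨m, rfl⟩ ⟨n, rfl⟩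
    refine ⟨m + n, ?_⟩
    ext z
    exact torusChar_add m n z

lemma torusChar_single (j : Fin 2) (x : Torus) :
    torusChar (Pi.single j 1) x = fourier 1 (x j) := by
  fin_cases j <;> simp [torusChar, Fin.prod_univ_two]

lemma charSubalgebra_separatesPoints : charSubalgebra.SeparatesPoints := by
  intro x y hxy
  rw [Ne, funext_iff, not_forall] at hxy
  obtain ⟨i, hi⟩ := hxy
  refine ⟨_, ⟨torusChar (Pi.single i 1), Algebra.subset_adjoin ⟨Pi.single i 1, rfl⟩, rfl⟩, ?_⟩
  dsimp only
  rw [torusChar_single, torusChar_single, fourier_one, fourier_one, Ne, Circle.coe_inj]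
  contrapose hi
  exact AddCircle.injective_toCircle Real.two_pi_pos.ne' hi

lemma span_torusChar_closure_eq_top :
    (Submodule.span ℂ (range torusChar)).topologicalClosure = ⊤ := by
  rw [← charSubalgebra_coe]
  exact congr_arg (Subalgebra.toSubmodule <| StarSubalgebra.toSubalgebra ·)
    (ContinuousMap.starSubalgebra_topologicalClosure_eq_top_of_separatesPoints _
      charSubalgebra_separatesPoints)

lemma integral_torusChar {k : Fin 2 → ℤ} (hk : k ≠ 0) : ∫ x, torusChar k x = 0 := by
  simp only [torusChar, ContinuousMap.coe_mk]
  rw [MeasureTheory.integral_fintype_prod_volume_eq_prod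
    (f := fun j (y : AddCircle (2 * Real.pi)) => (fourier (k j) y : ℂ))]
  obtain ⟨j, hj⟩ := Function.ne_iff.mp hk
  refine Finset.prod_eq_zero (Finset.mem_univ j) ?_
  exact integral_eq_zero_of_add_right_eq_neg (μ := volume)
    (fourier_add_half_inv_index hj Real.two_pi_pos)

lemma volume_torus : (volume : Measure Torus).real univ = (2 * Real.pi) ^ 2 := by
  simp [Measure.real, volume_pi, Measure.pi_univ, AddCircle.measure_univ,
    Real.pi_pos.le]

/-- The normalized characters `(2π)⁻¹ e^{i k · x}` in `L²(𝕋², ℂ)`. -/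
def charL2 (k : Fin 2 → ℤ) : Lp ℂ 2 (volume : Measure Torus) :=
  (((2 * Real.pi)⁻¹ : ℝ) : ℂ) • ContinuousMap.toLp (E := ℂ) 2 volume ℂ (torusChar k)

lemma orthonormal_charL2 : Orthonormal ℂ charL2 := by
  rw [orthonormal_iff_ite]
  intro m n
  simp only [charL2, inner_smul_left, inner_smul_right, ContinuousMap.inner_toLp,
    ← torusChar_neg, ← torusChar_add]
  split_ifs with h
  · simp only [h, add_neg_cancel, torusChar_zero, integral_const, volume_torus]
    have : (Real.pi : ℂ) ≠ 0 := by exact_mod_cast Real.pi_ne_zero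
    simp only [Complex.conj_ofReal, Complex.real_smul, mul_one]
    push_cast
    field_simp
  · rw [integral_torusChar (by rwa [← sub_eq_add_neg, sub_ne_zero, ne_comm])]
    simp

lemma span_charL2_closure_eq_top :
    (Submodule.span ℂ (range charL2)).topologicalClosure = ⊤ := by
  have h : (Submodule.span ℂ (range fun k =>
      ContinuousMap.toLp (E := ℂ) 2 (volume : Measure Torus) ℂ (torusChar k))).topologicalClosure
        = ⊤ := by
    simpa only [Submodule.map_span, ContinuousLinearMap.coe_coe, ← range_comp,
      Function.comp_def] using
      (ContinuousMap.toLp_denseRange ℂ (volume : Measure Torus) ℂ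
        (p := 2) (by norm_num)).topologicalClosure_map_submodule span_torusChar_closure_eq_top
  refine top_le_iff.1 (h.symm.le.trans (Submodule.topologicalClosure_mono ?_))
  rw [Submodule.span_le]
  rintro _ ⟨k, rfl⟩
  have hc : ((2 * Real.pi : ℝ) : ℂ) ≠ 0 := by
    exact_mod_cast Real.two_pi_pos.ne'
  have : ContinuousMap.toLp (E := ℂ) 2 (volume : Measure Torus) ℂ (torusChar k)
      = ((2 * Real.pi : ℝ) : ℂ) • charL2 k := by
    rw [charL2, Complex.ofReal_inv, smul_inv_smul₀ hc]
  simp only [this]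
  exact Submodule.smul_mem _ _ (Submodule.subset_span ⟨k, rfl⟩)

/-- The Fourier basis of `L²(𝕋², ℂ)`. -/
def charBasis : HilbertBasis (Fin 2 → ℤ) ℂ (Lp ℂ 2 (volume : Measure Torus)) :=
  HilbertBasis.mk orthonormal_charL2 span_charL2_closure_eq_top.ge

/-! ### The tight frame of real trigonometric functions -/

/-- The trigonometric functions as continuous functions. -/
def trigC (k : Fin 2 → ℤ) (m : Fin 2) : C(Torus, ℝ) where
  toFun := trig k m
  continuous_toFun := by
    unfold trig
    split_ifs <;> fun_prop

@[simp] lemma trigC_apply (k : Fin 2 → ℤ) (m : Fin 2) (x : Torus) : trigC k m x = trig k m x := rfl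

lemma trig_zero_eq (k : Fin 2 → ℤ) (x : Torus) : trig k 0 x = (torusChar k x).re := by
  simp [trig, torusChar]

lemma trig_one_eq (k : Fin 2 → ℤ) (x : Torus) : trig k 1 x = (torusChar k x).im := by
  simp [trig, torusChar]

lemma abs_trig_le (k : Fin 2 → ℤ) (m : Fin 2) (x : Torus) : |trig k m x| ≤ 1 := by
  fin_cases m
  · exact (trig_zero_eq k x ▸ Complex.abs_re_le_norm _).trans (norm_torusChar k x).le
  · exact (trig_one_eq k x ▸ Complex.abs_im_le_norm _).trans (norm_torusChar k x).le

/-- A continuous function as an element of `L²`. -/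
def toL2 (p : C(Torus, ℝ)) : L2 := ContinuousMap.toLp (E := ℝ) 2 volume ℝ p

lemma coeFn_toL2 (p : C(Torus, ℝ)) : toL2 p =ᵐ[volume] p := ContinuousMap.coeFn_toLp volume p

lemma toL2_smul (c : ℝ) (p : C(Torus, ℝ)) : toL2 (c • p) = c • toL2 p := map_smul _ _ _
lemma toL2_sum {ι : Type*} (s : Finset ι) (p : ι → C(Torus, ℝ)) :
    toL2 (∑ i ∈ s, p i) = ∑ i ∈ s, toL2 (p i) := map_sum _ _ _

lemma inner_toL2 (p : C(Torus, ℝ)) (f : L2) : inner ℝ (toL2 p) f = ∫ x, f x * p x := by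
  rw [MeasureTheory.L2.inner_def]
  refine integral_congr_ae ?_
  filter_upwards [coeFn_toL2 p] with x hx
  simp [hx]

/-- The pairing `∫ f(x) cos (k · x) dx` or `∫ f(x) sin (k · x) dx`. -/
def coef (f : L2) (k : Fin 2 → ℤ) (m : Fin 2) : ℝ := ∫ x, f x * trig k m x

lemma coef_eq_inner (f : L2) (k : Fin 2 → ℤ) (m : Fin 2) :
    coef f k m = inner ℝ (toL2 (trigC k m)) f := by
  rw [inner_toL2]
  rfl

lemma charBasis_smul_re (f : L2) (k : Fin 2 → ℤ) :
    Complex.reCLM.compLpL 2 volume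
      ((charBasis.repr (Complex.ofRealCLM.compLpL 2 volume f) k) • charBasis k)
      = ((2 * Real.pi) ^ 2)⁻¹ • ∑ m : Fin 2, coef f k m • toL2 (trigC k m) := by
  have hb : charBasis k = charL2 k := by simp [charBasis]
  have hrepr : charBasis.repr (Complex.ofRealCLM.compLpL 2 volume f) k
      = (((2 * Real.pi)⁻¹ : ℝ) : ℂ) * (coef f k 0 - coef f k 1 * Complex.I) := by
    rw [HilbertBasis.repr_apply_apply, hb, charL2, inner_smul_left, MeasureTheory.L2.inner_def]
    rw [Complex.conj_ofReal]
    congr 1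
    have h1 : ∫ x, inner ℂ (ContinuousMap.toLp (E := ℂ) 2 volume ℂ (torusChar k) x)
        (Complex.ofRealCLM.compLpL 2 volume f x)
        = ∫ x, (((f x * trig k 0 x : ℝ) : ℂ) - ((f x * trig k 1 x : ℝ) : ℂ) * Complex.I) := by
      refine integral_congr_ae ?_
      filter_upwards [ContinuousMap.coeFn_toLp (𝕜 := ℂ) (p := 2) volume (torusChar k),
        Complex.ofRealCLM.coeFn_compLpL (p := 2) (μ := volume) f] with x hx hx'
      rw [hx, hx', trig_zero_eq, trig_one_eq]
      apply Complex.ext <;> simp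
    have hint : ∀ m, Integrable (fun x => f x * trig k m x) := fun m => by
      have h2 := (Lp.memLp f).integrable (by norm_num)
      exact h2.mul_bdd (c := 1) (trigC k m).continuous.aestronglyMeasurable
        (Eventually.of_forall fun x => abs_trig_le k m x)
    rw [h1, integral_sub (hint 0).ofReal ((hint 1).ofReal.mul_const _), integral_mul_const,
      integral_complex_ofReal, integral_complex_ofReal]
    rfl
  rw [hrepr, hb, charL2, smul_smul]
  refine Lp.ext ?_
  simp only [Fin.sum_univ_two]
  filter_upwards [Complex.reCLM.coeFn_compLpL (p := 2) (μ := volume)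
      (((((2 * Real.pi)⁻¹ : ℝ) : ℂ) * (coef f k 0 - coef f k 1 * Complex.I)
      * (((2 * Real.pi)⁻¹ : ℝ) : ℂ)) •
        ContinuousMap.toLp (E := ℂ) 2 volume ℂ (torusChar k)),
    Lp.coeFn_smul ((((2 * Real.pi)⁻¹ : ℝ) : ℂ) * (coef f k 0 - coef f k 1 * Complex.I)
      * (((2 * Real.pi)⁻¹ : ℝ) : ℂ))
      (ContinuousMap.toLp (E := ℂ) 2 volume ℂ (torusChar k)),
    ContinuousMap.coeFn_toLp (𝕜 := ℂ) (p := 2) volume (torusChar k),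
    Lp.coeFn_smul (((2 * Real.pi) ^ 2)⁻¹ : ℝ) (coef f k 0 • toL2 (trigC k 0)
      + coef f k 1 • toL2 (trigC k 1)),
    Lp.coeFn_add (coef f k 0 • toL2 (trigC k 0)) (coef f k 1 • toL2 (trigC k 1)),
    Lp.coeFn_smul (coef f k 0) (toL2 (trigC k 0)), Lp.coeFn_smul (coef f k 1) (toL2 (trigC k 1)),
    coeFn_toL2 (trigC k 0), coeFn_toL2 (trigC k 1)] with x h1 h2 h3 h4 h5 h6 h7 h8 h9
  rw [h1, h2, h4, Pi.smul_apply, Pi.smul_apply, h5, Pi.add_apply, h6, h7, h3, Pi.smul_apply,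
    Pi.smul_apply, h8, h9, trigC_apply, trigC_apply, trig_zero_eq, trig_one_eq]
  have : ((((2 * Real.pi)⁻¹ : ℝ) : ℂ) * (coef f k 0 - coef f k 1 * Complex.I)
      * (((2 * Real.pi)⁻¹ : ℝ) : ℂ))
      = ((((2 * Real.pi) ^ 2)⁻¹ : ℝ) : ℂ) * (coef f k 0 - coef f k 1 * Complex.I) := by
    push_cast
    ring
  rw [this]
  generalize ((2 * Real.pi) ^ 2)⁻¹ = c
  simp
  ring

/-- The functions `(2π)⁻¹ cos (k · x)` and `(2π)⁻¹ sin (k · x)`, over all `k ∈ ℤ²`, form a tight frame of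
`L²`: it is redundant, since `k` and `-k` give the same functions up to sign, but the expansion of
`f` has the form of an orthonormal expansion. -/
theorem hasSum_trig (f : L2) :
    HasSum (fun k : Fin 2 → ℤ =>
      ((2 * Real.pi) ^ 2)⁻¹ • ∑ m : Fin 2, coef f k m • toL2 (trigC k m)) f := by
  have h := (charBasis.hasSum_repr (Complex.ofRealCLM.compLpL 2 volume f)).mapL
    (Complex.reCLM.compLpL 2 (volume : Measure Torus))
  simp only [charBasis_smul_re] at h
  convert h using 1
  refine Lp.ext ?_
  filter_upwards [Complex.reCLM.coeFn_compLpL (p := 2) (μ := volume)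
    (Complex.ofRealCLM.compLpL 2 volume f),
    Complex.ofRealCLM.coeFn_compLpL (p := 2) (μ := volume) f] with x h1 h2
  rw [h1, h2]
  simp

/-! ### Trigonometric polynomials and partial Fourier sums -/

/-- The normalized sum `(2π)⁻² ∑_{k ∈ F} ∑_m a k m` over a finite set `F` of wave vectors. -/
def frameSum (F : Finset (Fin 2 → ℤ)) (a : (Fin 2 → ℤ) → Fin 2 → ℝ) : ℝ :=
  ((2 * Real.pi) ^ 2)⁻¹ * ∑ k ∈ F, ∑ m : Fin 2, a k m

/-- The trigonometric polynomial with frame coefficients `c k m`, `k ∈ F`. -/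
def trigPoly (F : Finset (Fin 2 → ℤ)) (c : (Fin 2 → ℤ) → Fin 2 → ℝ) : C(Torus, ℝ) :=
  ((2 * Real.pi) ^ 2)⁻¹ • ∑ k ∈ F, ∑ m : Fin 2, c k m • trigC k m

/-- The partial Fourier sum of `f` over the wave vectors in `F`. -/
def proj (F : Finset (Fin 2 → ℤ)) (f : L2) : L2 := toL2 (trigPoly F (coef f))

lemma two_pi_sq_inv_pos : 0 < ((2 * Real.pi) ^ 2)⁻¹ := by positivity

lemma frameSum_add (F : Finset (Fin 2 → ℤ)) (a b : (Fin 2 → ℤ) → Fin 2 → ℝ) :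
    frameSum F (fun k m => a k m + b k m) = frameSum F a + frameSum F b := by
  simp only [frameSum, Finset.sum_add_distrib, mul_add]

lemma frameSum_mul_left (F : Finset (Fin 2 → ℤ)) (c : ℝ) (a : (Fin 2 → ℤ) → Fin 2 → ℝ) :
    frameSum F (fun k m => c * a k m) = c * frameSum F a := by
  simp only [frameSum, ← Finset.mul_sum]
  ring

lemma frameSum_mono {F : Finset (Fin 2 → ℤ)} {a b : (Fin 2 → ℤ) → Fin 2 → ℝ}
    (h : ∀ k m, a k m ≤ b k m) : frameSum F a ≤ frameSum F b :=
  mul_le_mul_of_nonneg_left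
    (Finset.sum_le_sum fun k _ => Finset.sum_le_sum fun m _ => h k m) two_pi_sq_inv_pos.le

lemma frameSum_nonneg {F : Finset (Fin 2 → ℤ)} {a : (Fin 2 → ℤ) → Fin 2 → ℝ}
    (h : ∀ k m, 0 ≤ a k m) : 0 ≤ frameSum F a :=
  mul_nonneg two_pi_sq_inv_pos.le
    (Finset.sum_nonneg fun k _ => Finset.sum_nonneg fun m _ => h k m)

lemma frameSum_swap (F : Finset (Fin 2 → ℤ)) (a : (Fin 2 → ℤ) → Fin 2 → ℝ) :
    frameSum F (fun k m => a k (1 - m)) = frameSum F a := by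
  simp [frameSum, Fin.sum_univ_two, add_comm]

lemma frameSum_cauchy_schwarz (F : Finset (Fin 2 → ℤ)) (a b : (Fin 2 → ℤ) → Fin 2 → ℝ) :
    frameSum F (fun k m => a k m * b k m) ^ 2
      ≤ frameSum F (fun k m => a k m ^ 2) * frameSum F (fun k m => b k m ^ 2) := by
  have h := Finset.sum_mul_sq_le_sq_mul_sq (F ×ˢ (Finset.univ : Finset (Fin 2)))
    (fun p => a p.1 p.2) (fun p => b p.1 p.2)
  simp only [Finset.sum_product] at h
  simp only [frameSum]
  calc _ = (((2 * Real.pi) ^ 2)⁻¹) ^ 2 * (∑ k ∈ F, ∑ m : Fin 2, a k m * b k m) ^ 2 := by ring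
    _ ≤ (((2 * Real.pi) ^ 2)⁻¹) ^ 2 * _ := mul_le_mul_of_nonneg_left h (by positivity)
    _ = _ := by ring

lemma trigPoly_apply (F : Finset (Fin 2 → ℤ)) (c : (Fin 2 → ℤ) → Fin 2 → ℝ) (x : Torus) :
    trigPoly F c x = frameSum F (fun k m => c k m * trig k m x) := by
  simp [trigPoly, frameSum]

lemma toL2_trigPoly (F : Finset (Fin 2 → ℤ)) (c : (Fin 2 → ℤ) → Fin 2 → ℝ) :
    toL2 (trigPoly F c)
      = ((2 * Real.pi) ^ 2)⁻¹ • ∑ k ∈ F, ∑ m : Fin 2, c k m • toL2 (trigC k m) := by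
  simp only [trigPoly, toL2_smul, toL2_sum]

lemma inner_trigPoly (F : Finset (Fin 2 → ℤ)) (c : (Fin 2 → ℤ) → Fin 2 → ℝ) (f : L2) :
    inner ℝ (toL2 (trigPoly F c)) f = frameSum F (fun k m => c k m * coef f k m) := by
  simp only [toL2_trigPoly, real_inner_smul_left, sum_inner, ← coef_eq_inner, frameSum]

lemma coef_sub (f h : L2) (k : Fin 2 → ℤ) (m : Fin 2) :
    coef (f - h) k m = coef f k m - coef h k m := by
  simp only [coef_eq_inner, inner_sub_right]

lemma coef_add (f h : L2) (k : Fin 2 → ℤ) (m : Fin 2) :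
    coef (f + h) k m = coef f k m + coef h k m := by
  simp only [coef_eq_inner, inner_add_right]

lemma continuous_coef (k : Fin 2 → ℤ) (m : Fin 2) : Continuous fun f => coef f k m := by
  simp only [coef_eq_inner]
  fun_prop

lemma tendsto_proj (f : L2) : Tendsto (fun F => proj F f) atTop (𝓝 f) := by
  have h := hasSum_trig f
  rw [HasSum, SummationFilter.unconditional_filter] at h
  simpa only [proj, ← Finset.smul_sum, ← toL2_trigPoly] using h

lemma tendsto_frameSum_coef_sq (f : L2) :
    Tendsto (fun F => frameSum F (fun k m => coef f k m ^ 2)) atTop (𝓝 (‖f‖ ^ 2)) := by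
  have h := (tendsto_proj f).inner (tendsto_const_nhds (x := f)) (𝕜 := ℝ)
  simpa only [proj, inner_trigPoly, ← pow_two, real_inner_self_eq_norm_sq] using h

lemma frameSum_coef_sq_le (F : Finset (Fin 2 → ℤ)) (f : L2) :
    frameSum F (fun k m => coef f k m ^ 2) ≤ ‖f‖ ^ 2 := by
  refine Monotone.ge_of_tendsto (fun F G hFG => ?_) (tendsto_frameSum_coef_sq f) F
  exact mul_le_mul_of_nonneg_left (Finset.sum_le_sum_of_subset_of_nonneg hFG fun _ _ _ =>
    Finset.sum_nonneg fun _ _ => sq_nonneg _) two_pi_sq_inv_pos.le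

/-- The synthesis operator of the tight frame is a contraction. -/
lemma norm_toL2_trigPoly_sq_le (F : Finset (Fin 2 → ℤ)) (c : (Fin 2 → ℤ) → Fin 2 → ℝ) :
    ‖toL2 (trigPoly F c)‖ ^ 2 ≤ frameSum F (fun k m => c k m ^ 2) := by
  set N := ‖toL2 (trigPoly F c)‖ ^ 2 with hN
  have h1 : N = frameSum F (fun k m => c k m * coef (toL2 (trigPoly F c)) k m) := by
    rw [hN, ← real_inner_self_eq_norm_sq, inner_trigPoly]
  have h2 := frameSum_cauchy_schwarz F c (coef (toL2 (trigPoly F c)))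
  rw [← h1] at h2
  have h3 := frameSum_coef_sq_le F (toL2 (trigPoly F c))
  have h4 : 0 ≤ frameSum F (fun k m => c k m ^ 2) := frameSum_nonneg fun _ _ => sq_nonneg _
  have hN0 : 0 ≤ N := sq_nonneg _
  rcases hN0.eq_or_lt with h | h
  · rw [← h]
    exact h4
  · have : N * N ≤ frameSum F (fun k m => c k m ^ 2) * N := by
      calc N * N = N ^ 2 := by ring
        _ ≤ _ := h2
        _ ≤ _ := mul_le_mul_of_nonneg_left h3 h4
    exact le_of_mul_le_mul_right this h

lemma norm_proj_le (F : Finset (Fin 2 → ℤ)) (f : L2) : ‖proj F f‖ ≤ ‖f‖ :=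
  le_of_sq_le_sq ((norm_toL2_trigPoly_sq_le F _).trans (frameSum_coef_sq_le F f)) (norm_nonneg _)

lemma norm_sub_proj_le (F : Finset (Fin 2 → ℤ)) (f : L2) : ‖f - proj F f‖ ≤ 2 * ‖f‖ := by
  have := norm_sub_le f (proj F f)
  have := norm_proj_le F f
  linarith

lemma continuous_proj (F : Finset (Fin 2 → ℤ)) : Continuous (proj F) := by
  unfold proj
  simp only [toL2_trigPoly]
  have := continuous_coef
  fun_prop

lemma proj_add (F : Finset (Fin 2 → ℤ)) (f h : L2) : proj F (f + h) = proj F f + proj F h := by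
  simp only [proj, toL2_trigPoly, coef_add, add_smul, Finset.sum_add_distrib, smul_add]

lemma norm_sq_sub_frameSum_le (F : Finset (Fin 2 → ℤ)) (f : L2) :
    ‖f‖ ^ 2 - frameSum F (fun k m => coef f k m ^ 2) ≤ ‖f‖ * ‖f - proj F f‖ := by
  have h : inner ℝ (f - proj F f) f
      = ‖f‖ ^ 2 - frameSum F (fun k m => coef f k m ^ 2) := by
    rw [inner_sub_left, real_inner_self_eq_norm_sq, proj, inner_trigPoly]
    simp only [pow_two]
  rw [← h]
  exact (real_inner_le_norm _ _).trans_eq (mul_comm _ _)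

lemma abs_trigPoly_apply_le (F : Finset (Fin 2 → ℤ)) (c : (Fin 2 → ℤ) → Fin 2 → ℝ) (x : Torus) :
    |trigPoly F c x| ≤ frameSum F (fun k m => |c k m|) := by
  rw [trigPoly_apply, frameSum, frameSum, abs_mul, abs_of_pos two_pi_sq_inv_pos]
  refine mul_le_mul_of_nonneg_left ((Finset.abs_sum_le_sum_abs _ _).trans
    (Finset.sum_le_sum fun k _ => (Finset.abs_sum_le_sum_abs _ _).trans
      (Finset.sum_le_sum fun m _ => ?_))) two_pi_sq_inv_pos.le
  rw [abs_mul]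
  exact mul_le_of_le_one_right (abs_nonneg _) (abs_trig_le k m x)

/-! ### Derivatives of trigonometric polynomials -/

/-- The frame coefficients of `∂_j p` in terms of those of the trigonometric polynomial `p`. -/
def gradCoef (j : Fin 2) (c : (Fin 2 → ℤ) → Fin 2 → ℝ) (k : Fin 2 → ℤ) (m : Fin 2) : ℝ :=
  if m = 0 then k j * c k 1 else -(k j * c k 0)

/-- The sign with which `∂_j` exchanges `cos (k · x)` and `sin (k · x)`. -/
def trigSign (m : Fin 2) : ℝ := if m = 0 then -1 else 1

lemma trigSign_sq (m : Fin 2) : trigSign m ^ 2 = 1 := by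
  unfold trigSign
  split_ifs <;> norm_num

lemma gradCoef_sq (j : Fin 2) (c : (Fin 2 → ℤ) → Fin 2 → ℝ) (k : Fin 2 → ℤ) (m : Fin 2) :
    gradCoef j c k m ^ 2 = (k j : ℝ) ^ 2 * c k (1 - m) ^ 2 := by
  fin_cases m <;> simp [gradCoef] <;> ring

lemma torusChar_add_single (k : Fin 2 → ℤ) (x : Torus) (j : Fin 2)
    (s : AddCircle (2 * Real.pi)) :
    torusChar k (x + Pi.single j s) = torusChar k x * fourier (k j) s := by
  fin_cases j <;>
  simp [torusChar, Fin.prod_univ_two, fourier_apply, smul_add, AddCircle.toCircle_add] <;> ring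

lemma hasDerivAt_torusChar (k : Fin 2 → ℤ) (x : Torus) (j : Fin 2) :
    HasDerivAt (fun s : ℝ => torusChar k (x + Pi.single j (s : AddCircle (2 * Real.pi))))
      (torusChar k x * (k j * Complex.I)) 0 := by
  simp only [torusChar_add_single]
  refine HasDerivAt.const_mul _ ?_
  have h := hasDerivAt_fourier (2 * Real.pi) (k j) 0
  convert! h using 1
  have : (Real.pi : ℂ) ≠ 0 := by exact_mod_cast Real.pi_ne_zero
  simp
  field_simp

lemma hasDerivAt_trig (k : Fin 2 → ℤ) (m : Fin 2) (x : Torus) (j : Fin 2) :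
    HasDerivAt (fun s : ℝ => trig k m (x + Pi.single j (s : AddCircle (2 * Real.pi))))
      (trigSign m * k j * trig k (1 - m) x) 0 := by
  have h := hasDerivAt_torusChar k x j
  fin_cases m
  · have h' := Complex.reCLM.hasFDerivAt.comp_hasDerivAt (0 : ℝ) h
    simp only [Fin.zero_eta, Fin.isValue, trig_zero_eq, sub_zero, trig_one_eq, trigSign]
    convert! h' using 1
    simp
    ring
  · have h' := Complex.imCLM.hasFDerivAt.comp_hasDerivAt (0 : ℝ) h
    simp only [Fin.mk_one, Fin.isValue, trig_zero_eq, sub_self, trig_one_eq, trigSign]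
    convert! h' using 1
    simp
    ring

lemma partialD_trig (j : Fin 2) (k : Fin 2 → ℤ) (m : Fin 2) (x : Torus) :
    partialD j (trig k m) x = trigSign m * k j * trig k (1 - m) x :=
  (hasDerivAt_trig k m x j).deriv

/-- The squared length `|k|²` of a wave vector. -/
def waveSq (k : Fin 2 → ℤ) : ℝ := (k 0 : ℝ) ^ 2 + (k 1 : ℝ) ^ 2

lemma waveSq_nonneg (k : Fin 2 → ℤ) : 0 ≤ waveSq k := by unfold waveSq; positivity

lemma one_le_waveSq {k : Fin 2 → ℤ} (hk : k ≠ 0) : 1 ≤ waveSq k := by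
  have : 0 < (k 0) ^ 2 + (k 1) ^ 2 := by
    by_contra! h
    apply hk
    have h0 : k 0 = 0 := by nlinarith [sq_nonneg (k 0), sq_nonneg (k 1)]
    have h1 : k 1 = 0 := by nlinarith [sq_nonneg (k 0), sq_nonneg (k 1)]
    ext j
    fin_cases j <;> simp [h0, h1]
  unfold waveSq
  exact_mod_cast this

lemma laplacian_trig (k : Fin 2 → ℤ) (m : Fin 2) (x : Torus) :
    laplacian (trig k m) x = -waveSq k * trig k m x := by
  have h : ∀ j, partialD j (partialD j (trig k m)) x = -(k j : ℝ) ^ 2 * trig k m x := by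
    intro j
    have h1 : partialD j (trig k m) = fun y => trigSign m * k j * trig k (1 - m) y :=
      funext fun y => partialD_trig j k m y
    rw [h1]
    refine ((hasDerivAt_trig k (1 - m) x j).const_mul _).deriv.trans ?_
    fin_cases m <;> simp [trigSign] <;> ring
  simp only [laplacian, h, Fin.sum_univ_two, waveSq]
  ring

lemma hasDerivAt_trigPoly (F : Finset (Fin 2 → ℤ)) (c : (Fin 2 → ℤ) → Fin 2 → ℝ) (j : Fin 2)
    (x : Torus) :
    HasDerivAt (fun s : ℝ => trigPoly F c (x + Pi.single j (s : AddCircle (2 * Real.pi))))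
      (trigPoly F (gradCoef j c) x) 0 := by
  simp only [trigPoly_apply, frameSum]
  refine HasDerivAt.const_mul _ (HasDerivAt.fun_sum fun k _ => ?_)
  have h : ∑ m : Fin 2, gradCoef j c k m * trig k m x
      = ∑ m : Fin 2, c k m * (trigSign m * k j * trig k (1 - m) x) := by
    simp [Fin.sum_univ_two, gradCoef, trigSign]
    ring
  rw [h]
  exact HasDerivAt.fun_sum fun m _ => (hasDerivAt_trig k m x j).const_mul _

lemma isSmooth_trig (k : Fin 2 → ℤ) (m : Fin 2) : IsSmooth (trig k m) := by
  have h : ContDiff ℝ ((⊤ : ℕ∞) : WithTop ℕ∞)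
      (fun x : Fin 2 → ℝ => torusChar k (fun i => (x i : AddCircle (2 * Real.pi)))) := by
    simp only [torusChar, ContinuousMap.coe_mk, fourier_coe_apply, Fin.prod_univ_two]
    have h0 : ∀ j : Fin 2, ContDiff ℝ ((⊤ : ℕ∞) : WithTop ℕ∞)
        (fun x : Fin 2 → ℝ => ((x j : ℝ) : ℂ)) := fun j =>
      Complex.ofRealCLM.contDiff.comp (contDiff_apply ℝ ℝ j)
    have := h0 0
    have := h0 1
    fun_prop
  unfold IsSmooth
  fin_cases m
  · simp only [Fin.zero_eta, trig_zero_eq]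
    exact Complex.reCLM.contDiff.comp h
  · simp only [Fin.mk_one, trig_one_eq]
    exact Complex.imCLM.contDiff.comp h

lemma isSmooth_trigPoly (F : Finset (Fin 2 → ℤ)) (c : (Fin 2 → ℤ) → Fin 2 → ℝ) :
    IsSmooth (trigPoly F c) := by
  unfold IsSmooth
  simp only [trigPoly_apply, frameSum]
  refine contDiff_const.mul (ContDiff.sum fun k _ => ContDiff.sum fun m _ => ?_)
  exact contDiff_const.mul (isSmooth_trig k m)

/-! ### Products with continuous functions -/

lemma memLp_mulC (p : C(Torus, ℝ)) (h : L2) :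
    MemLp (fun x => p x * h x) 2 (volume : Measure Torus) := by
  refine MemLp.of_le_mul (c := ‖p‖) (Lp.memLp h)
    (p.continuous.aestronglyMeasurable.mul (Lp.aestronglyMeasurable h)) ?_
  refine Eventually.of_forall fun x => ?_
  rw [norm_mul]
  exact mul_le_mul_of_nonneg_right (p.norm_coe_le_norm x) (norm_nonneg _)

/-- Multiplication of an `L²` function by a continuous function. -/
def mulC (p : C(Torus, ℝ)) (h : L2) : L2 := (memLp_mulC p h).toLp

lemma coeFn_mulC (p : C(Torus, ℝ)) (h : L2) : mulC p h =ᵐ[volume] fun x => p x * h x :=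
  (memLp_mulC p h).coeFn_toLp

lemma norm_mulC_le {p : C(Torus, ℝ)} {M : ℝ} (hp : ∀ x, |p x| ≤ M) (h : L2) :
    ‖mulC p h‖ ≤ M * ‖h‖ := by
  refine Lp.norm_le_mul_norm_of_ae_le_mul ?_
  filter_upwards [coeFn_mulC p h] with x hx
  rw [hx, norm_mul]
  exact mul_le_mul_of_nonneg_right (hp x) (norm_nonneg _)

/-- The trilinear form `∫ f h p dx` for square integrable `f`, `h` and continuous `p`. -/
def tri (f h : L2) (p : C(Torus, ℝ)) : ℝ := ∫ x, f x * (h x * p x)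

lemma integrable_mul_continuous (f : L2) (p : C(Torus, ℝ)) : Integrable (fun x => f x * p x) :=
  ((Lp.memLp f).integrable (by norm_num)).mul_bdd (c := ‖p‖) p.continuous.aestronglyMeasurable
    (Eventually.of_forall fun x => p.norm_coe_le_norm x)

lemma integrable_tri (f h : L2) (p : C(Torus, ℝ)) :
    Integrable (fun x => f x * (h x * p x)) := by
  refine (L2.integrable_inner (𝕜 := ℝ) f (mulC p h)).congr ?_
  filter_upwards [coeFn_mulC p h] with x hx
  simp [hx]
  ring

lemma tri_eq_inner (f h : L2) (p : C(Torus, ℝ)) : tri f h p = inner ℝ f (mulC p h) := by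
  rw [L2.inner_def]
  refine integral_congr_ae ?_
  filter_upwards [coeFn_mulC p h] with x hx
  simp [hx]
  ring

lemma tri_toL2 (f : L2) (q p : C(Torus, ℝ)) : tri f (toL2 q) p = inner ℝ f (mulC q (toL2 p)) := by
  rw [L2.inner_def]
  refine integral_congr_ae ?_
  filter_upwards [coeFn_mulC q (toL2 p), coeFn_toL2 q, coeFn_toL2 p] with x hx h1 h2
  simp [hx, h1, h2]
  ring

lemma abs_tri_le (f h : L2) {p : C(Torus, ℝ)} {M : ℝ} (hp : ∀ x, |p x| ≤ M) :
    |tri f h p| ≤ M * ‖f‖ * ‖h‖ := by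
  rw [tri_eq_inner]
  calc _ ≤ ‖f‖ * ‖mulC p h‖ := abs_real_inner_le_norm _ _
    _ ≤ ‖f‖ * (M * ‖h‖) := mul_le_mul_of_nonneg_left (norm_mulC_le hp h) (norm_nonneg _)
    _ = _ := by ring

lemma tri_sub_left (f f' h : L2) (p : C(Torus, ℝ)) :
    tri (f - f') h p = tri f h p - tri f' h p := by
  simp only [tri_eq_inner, inner_sub_left]

lemma tri_add_left (f f' h : L2) (p : C(Torus, ℝ)) :
    tri (f + f') h p = tri f h p + tri f' h p := by
  simp only [tri_eq_inner, inner_add_left]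

lemma tri_comm (f h : L2) (p : C(Torus, ℝ)) : tri f h p = tri h f p := by
  unfold tri
  congr 1
  ext x
  ring

lemma tri_sub_mid (f h h' : L2) (p : C(Torus, ℝ)) :
    tri f (h - h') p = tri f h p - tri f h' p := by
  rw [tri_comm, tri_sub_left, tri_comm h, tri_comm h']

/-- If all partial Fourier sums of `h` are bounded by `M`, then `|∫ f h p| ≤ M ‖f‖ ‖p‖` with the `L²`
norm of `p`: this stands in for a bound of `h` in `L^∞`. -/
lemma abs_tri_le_of_trigPoly_le (f h : L2) (p : C(Torus, ℝ)) {M : ℝ}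
    (hM : ∀ F x, |trigPoly F (coef h) x| ≤ M) : |tri f h p| ≤ M * ‖f‖ * ‖toL2 p‖ := by
  have hlim : Tendsto (fun F => tri f (proj F h) p) atTop (𝓝 (tri f h p)) := by
    have h1 : Tendsto (fun F => tri f h p - tri f (h - proj F h) p) atTop
        (𝓝 (tri f h p - 0)) := by
      refine tendsto_const_nhds.sub ?_
      have h2 : Tendsto (fun F => ‖p‖ * ‖f‖ * ‖h - proj F h‖) atTop (𝓝 (‖p‖ * ‖f‖ * 0)) := by
        refine tendsto_const_nhds.mul ?_
        have := (tendsto_const_nhds (x := h)).sub (tendsto_proj h)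
        simpa using this.norm
      rw [mul_zero] at h2
      exact squeeze_zero_norm (fun F => abs_tri_le f _ p.norm_coe_le_norm) h2
    simpa [tri_sub_mid] using h1
  refine le_of_tendsto hlim.abs (Eventually.of_forall fun F => ?_)
  rw [proj, tri_toL2]
  calc _ ≤ ‖f‖ * ‖mulC (trigPoly F (coef h)) (toL2 p)‖ := abs_real_inner_le_norm _ _
    _ ≤ ‖f‖ * (M * ‖toL2 p‖) :=
      mul_le_mul_of_nonneg_left (norm_mulC_le (hM F) _) (norm_nonneg _)
    _ = _ := by ring

/-! ### The Biot-Savart law in Fourier variables -/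

lemma coef_zero_of_mean_zero {f : L2} (hf : ∫ x, f x = 0) (m : Fin 2) : coef f 0 m = 0 := by
  fin_cases m
  · simpa [coef, trig_zero_eq, torusChar_zero] using hf
  · simp [coef, trig_one_eq, torusChar_zero]

lemma integral_mul_partialD_trig (f : L2) (k : Fin 2 → ℤ) (m j : Fin 2) :
    ∫ x, f x * partialD j (trig k m) x = trigSign m * k j * coef f k (1 - m) := by
  rw [coef, ← integral_const_mul]
  congr 1
  ext x
  rw [partialD_trig]
  ring

lemma integrable_mul_partialD_trig (f : L2) (k : Fin 2 → ℤ) (m j : Fin 2) :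
    Integrable fun x => f x * partialD j (trig k m) x := by
  refine ((integrable_mul_continuous f (trigC k (1 - m))).const_mul
    (trigSign m * k j)).congr (Eventually.of_forall fun x => ?_)
  simp only [partialD_trig, trigC_apply]
  ring

lemma HasWeakPartial.coef_eq {j : Fin 2} {f D : L2} (h : HasWeakPartial j f D)
    (k : Fin 2 → ℤ) (m : Fin 2) : coef D k m = -(trigSign m * k j * coef f k (1 - m)) := by
  have := h (trig k m) (isSmooth_trig k m)
  rw [integral_mul_partialD_trig] at this
  rw [this, neg_neg]
  rfl

/-- The Biot-Savart law expressed by frame coefficients, a condition that is visibly linear in the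
pair `(w, u)`. -/
structure FourierBiotSavart (w : L2) (u : Fin 2 → L2) : Prop where
  coef_zero : ∀ j m, coef (u j) 0 m = 0
  div_free : ∀ (k : Fin 2 → ℤ) m, k 0 * coef (u 0) k m + k 1 * coef (u 1) k m = 0
  curl_eq : ∀ (k : Fin 2 → ℤ) m,
    k 1 * coef (u 0) k m - k 0 * coef (u 1) k m = trigSign (1 - m) * coef w k (1 - m)

lemma IsBiotSavart.fourier {w : L2} {u : Fin 2 → L2} (h : IsBiotSavart w u) :
    FourierBiotSavart w u := by
  refine ⟨fun j m => coef_zero_of_mean_zero (h.mean_zero j) m, fun k m => ?_, fun k m => ?_⟩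
  · have h1 := h.div_free _ (isSmooth_trig k (1 - m))
    rw [integral_add (integrable_mul_partialD_trig _ _ _ _)
      (integrable_mul_partialD_trig _ _ _ _), integral_mul_partialD_trig,
      integral_mul_partialD_trig, sub_sub_cancel] at h1
    linear_combination trigSign (1 - m) * h1 - (k 0 * coef (u 0) k m + k 1 * coef (u 1) k m)
      * trigSign_sq (1 - m)
  · have h2 := h.curl_eq _ (isSmooth_trig k (1 - m))
    rw [integral_sub (integrable_mul_partialD_trig _ _ _ _)
      (integrable_mul_partialD_trig _ _ _ _), integral_mul_partialD_trig,
      integral_mul_partialD_trig, sub_sub_cancel, ← coef] at h2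
    linear_combination trigSign (1 - m) * h2 - (k 1 * coef (u 0) k m - k 0 * coef (u 1) k m)
      * trigSign_sq (1 - m)

lemma FourierBiotSavart.sub {w w' : L2} {u u' : Fin 2 → L2} (h : FourierBiotSavart w u)
    (h' : FourierBiotSavart w' u') : FourierBiotSavart (w - w') (fun j => u j - u' j) := by
  refine ⟨fun j m => ?_, fun k m => ?_, fun k m => ?_⟩ <;> simp only [coef_sub]
  · rw [h.coef_zero, h'.coef_zero, sub_zero]
  · linear_combination h.div_free k m - h'.div_free k m
  · linear_combination h.curl_eq k m - h'.curl_eq k m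

lemma FourierBiotSavart.waveSq_mul {w : L2} {u : Fin 2 → L2} (h : FourierBiotSavart w u)
    (k : Fin 2 → ℤ) (m : Fin 2) :
    waveSq k * (coef (u 0) k m ^ 2 + coef (u 1) k m ^ 2) = coef w k (1 - m) ^ 2 := by
  have h1 := h.div_free k m
  have h2 := h.curl_eq k m
  have hs := trigSign_sq (1 - m)
  rw [waveSq]
  linear_combination (k 0 * coef (u 0) k m + k 1 * coef (u 1) k m) * h1
    + (k 1 * coef (u 0) k m - k 0 * coef (u 1) k m + trigSign (1 - m) * coef w k (1 - m)) * h2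
    + coef w k (1 - m) ^ 2 * hs

lemma coef_sq_le_add (u : Fin 2 → L2) (j : Fin 2) (k : Fin 2 → ℤ) (m : Fin 2) :
    coef (u j) k m ^ 2 ≤ coef (u 0) k m ^ 2 + coef (u 1) k m ^ 2 := by
  fin_cases j
  · simpa using sq_nonneg _
  · simpa using sq_nonneg _

lemma FourierBiotSavart.coef_sq_le {w : L2} {u : Fin 2 → L2} (h : FourierBiotSavart w u)
    (j : Fin 2) (k : Fin 2 → ℤ) (m : Fin 2) : coef (u j) k m ^ 2 ≤ coef w k (1 - m) ^ 2 := by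
  by_cases hk : k = 0
  · rw [hk, h.coef_zero]
    simpa using sq_nonneg _
  have h1 := h.waveSq_mul k m
  have h2 := one_le_waveSq hk
  have h3 := coef_sq_le_add u j k m
  nlinarith [sq_nonneg (coef (u 0) k m), sq_nonneg (coef (u 1) k m)]

lemma FourierBiotSavart.norm_le {w : L2} {u : Fin 2 → L2} (h : FourierBiotSavart w u)
    (j : Fin 2) : ‖u j‖ ≤ ‖w‖ := by
  refine le_of_sq_le_sq ?_ (norm_nonneg _)
  refine le_of_tendsto (tendsto_frameSum_coef_sq (u j)) (Eventually.of_forall fun F => ?_)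
  refine (frameSum_mono (h.coef_sq_le j)).trans ?_
  rw [frameSum_swap F (fun k m => coef w k m ^ 2)]
  exact frameSum_coef_sq_le F w

lemma summable_inv_waveSq_sq : Summable fun k : Fin 2 → ℤ => (waveSq k ^ 2)⁻¹ := by
  have hs := EisensteinSeries.summable_one_div_norm_rpow (k := 4) (by norm_num)
  refine Summable.of_nonneg_of_le (fun k => by positivity) (fun k => ?_) hs
  by_cases hk : k = 0
  · simp [hk, waveSq]
  have hpos : 0 < ‖k‖ := norm_pos_iff.2 hk
  rw [Real.rpow_neg hpos.le]
  refine inv_anti₀ (by positivity) ?_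
  have h1 : ‖k‖ ^ 2 ≤ waveSq k := by
    have : ‖k‖ ≤ Real.sqrt (waveSq k) := by
      refine (pi_norm_le_iff_of_nonneg (Real.sqrt_nonneg _)).2 fun j => Real.le_sqrt_of_sq_le ?_
      rw [Int.norm_eq_abs, sq_abs, waveSq]
      fin_cases j
      · simpa using sq_nonneg _
      · simpa using sq_nonneg _
    calc ‖k‖ ^ 2 ≤ Real.sqrt (waveSq k) ^ 2 := by gcongr
      _ = _ := Real.sq_sqrt (waveSq_nonneg k)
  calc ‖k‖ ^ (4 : ℝ) = (‖k‖ ^ 2) ^ 2 := by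
        rw [← pow_mul, ← Real.rpow_natCast]
        norm_num
    _ ≤ _ := by gcongr

/-- A velocity field whose vorticity has a square integrable gradient has uniformly bounded
partial Fourier sums, because `∑ |k|⁻⁴` converges over the nonzero wave vectors of the plane. -/
lemma exists_velocity_bound : ∃ K : ℝ, 0 ≤ K ∧ ∀ (w : L2) (u D : Fin 2 → L2),
    FourierBiotSavart w u → (∀ j, HasWeakPartial j w (D j)) →
    ∀ j F x, |trigPoly F (coef (u j)) x| ≤ K * Real.sqrt (‖D 0‖ ^ 2 + ‖D 1‖ ^ 2) := by
  set Q : ℝ := ((2 * Real.pi) ^ 2)⁻¹ * (2 * ∑' k : Fin 2 → ℤ, (waveSq k ^ 2)⁻¹) with hQ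
  refine ⟨Real.sqrt Q, Real.sqrt_nonneg _, fun w u D hu hD j F x => ?_⟩
  refine (abs_trigPoly_apply_le F _ x).trans ?_
  set d : (Fin 2 → ℤ) → Fin 2 → ℝ :=
    fun k m => Real.sqrt (coef (D 0) k m ^ 2 + coef (D 1) k m ^ 2) with hd
  have hpt : ∀ k m, |coef (u j) k m| ≤ (waveSq k)⁻¹ * d k m := by
    intro k m
    by_cases hk : k = 0
    -- both sides vanish, since `(waveSq 0)⁻¹ = 0⁻¹ = 0`
    · rw [hk, hu.coef_zero]
      simp [waveSq]
    have hq : 0 < waveSq k := lt_of_lt_of_le one_pos (one_le_waveSq hk)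
    rw [le_inv_mul_iff₀ hq]
    refine Real.le_sqrt_of_sq_le ?_
    have h1 := hu.waveSq_mul k m
    have h2 : coef (D 0) k m ^ 2 + coef (D 1) k m ^ 2 = waveSq k * coef w k (1 - m) ^ 2 := by
      rw [(hD 0).coef_eq, (hD 1).coef_eq, waveSq]
      linear_combination (k 0 ^ 2 + k 1 ^ 2) * coef w k (1 - m) ^ 2 * trigSign_sq m
    rw [h2, ← h1, mul_pow, sq_abs]
    have h3 := coef_sq_le_add u j k m
    nlinarith [mul_le_mul_of_nonneg_left h3 (sq_nonneg (waveSq k))]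
  refine (frameSum_mono hpt).trans ?_
  rw [← Real.sqrt_mul (by positivity)]
  refine Real.le_sqrt_of_sq_le ((frameSum_cauchy_schwarz F _ d).trans ?_)
  refine mul_le_mul ?_ ?_ (frameSum_nonneg fun _ _ => sq_nonneg _) (by positivity)
  · refine mul_le_mul_of_nonneg_left ?_ two_pi_sq_inv_pos.le
    simp only [Finset.sum_const, Finset.card_univ, Fintype.card_fin, nsmul_eq_mul,
      ← Finset.mul_sum, inv_pow]
    refine mul_le_mul_of_nonneg_left ?_ (by norm_num)
    exact summable_inv_waveSq_sq.sum_le_tsum _ fun _ _ => by positivity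
  · have h4 : ∀ k m, d k m ^ 2 = coef (D 0) k m ^ 2 + coef (D 1) k m ^ 2 := fun k m =>
      Real.sq_sqrt (by positivity)
    simp only [h4, frameSum_add]
    exact add_le_add (frameSum_coef_sq_le F _) (frameSum_coef_sq_le F _)

/-! ### Transport and diffusion of a partial Fourier sum -/

/-- The squared `L²` norm of the gradient, in terms of frame coefficients. -/
def gradSum (F : Finset (Fin 2 → ℤ)) (c : (Fin 2 → ℤ) → Fin 2 → ℝ) : ℝ :=
  frameSum F (fun k m => waveSq k * c k m ^ 2)

lemma gradSum_nonneg (F : Finset (Fin 2 → ℤ)) (c : (Fin 2 → ℤ) → Fin 2 → ℝ) :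
    0 ≤ gradSum F c :=
  frameSum_nonneg fun k _ => mul_nonneg (waveSq_nonneg k) (sq_nonneg _)

lemma frameSum_gradCoef_sq (F : Finset (Fin 2 → ℤ)) (c : (Fin 2 → ℤ) → Fin 2 → ℝ) :
    frameSum F (fun k m => gradCoef 0 c k m ^ 2) + frameSum F (fun k m => gradCoef 1 c k m ^ 2)
      = gradSum F c := by
  simp only [gradCoef_sq, ← frameSum_add, ← add_mul]
  exact frameSum_swap F (fun k m => waveSq k * c k m ^ 2)

lemma norm_grad_sq_le (F : Finset (Fin 2 → ℤ)) (c : (Fin 2 → ℤ) → Fin 2 → ℝ) :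
    ‖toL2 (trigPoly F (gradCoef 0 c))‖ ^ 2 + ‖toL2 (trigPoly F (gradCoef 1 c))‖ ^ 2
      ≤ gradSum F c := by
  rw [← frameSum_gradCoef_sq]
  exact add_le_add (norm_toL2_trigPoly_sq_le F _) (norm_toL2_trigPoly_sq_le F _)

/-- Poincaré inequality for mean-zero frame coefficients. -/
lemma frameSum_sq_le_gradSum (F : Finset (Fin 2 → ℤ)) {c : (Fin 2 → ℤ) → Fin 2 → ℝ}
    (hc : ∀ m, c 0 m = 0) : frameSum F (fun k m => c k m ^ 2) ≤ gradSum F c := by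
  refine frameSum_mono fun k m => ?_
  by_cases hk : k = 0
  · simp [hk, hc]
  · exact le_mul_of_one_le_left (sq_nonneg _) (one_le_waveSq hk)

/-- The advection term `∫ f (u · ∇) p` for the trigonometric polynomial `p` with coefficients `c`. -/
def transport (f : L2) (u : Fin 2 → L2) (F : Finset (Fin 2 → ℤ))
    (c : (Fin 2 → ℤ) → Fin 2 → ℝ) : ℝ :=
  tri f (u 0) (trigPoly F (gradCoef 0 c)) + tri f (u 1) (trigPoly F (gradCoef 1 c))

lemma transport_add_left (f f' : L2) (u : Fin 2 → L2) (F : Finset (Fin 2 → ℤ))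
    (c : (Fin 2 → ℤ) → Fin 2 → ℝ) :
    transport (f + f') u F c = transport f u F c + transport f' u F c := by
  simp only [transport, tri_add_left]
  ring

lemma sq_le_of_abs_add_le {x y M n₀ n₁ N : ℝ} (hx : |x| ≤ M * n₀) (hy : |y| ≤ M * n₁)
    (hN : n₀ ^ 2 + n₁ ^ 2 ≤ N) : (x + y) ^ 2 ≤ 2 * M ^ 2 * N := by
  have h1 : x ^ 2 ≤ (M * n₀) ^ 2 := sq_le_sq' (abs_le.1 hx).1 (abs_le.1 hx).2
  have h2 : y ^ 2 ≤ (M * n₁) ^ 2 := sq_le_sq' (abs_le.1 hy).1 (abs_le.1 hy).2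
  nlinarith [sq_nonneg (x - y), mul_le_mul_of_nonneg_left hN (sq_nonneg M)]

lemma trigPoly_transport_self {w : L2} {u : Fin 2 → L2} (hu : IsBiotSavart w u)
    (F : Finset (Fin 2 → ℤ)) (c : (Fin 2 → ℤ) → Fin 2 → ℝ) :
    transport (toL2 (trigPoly F c)) u F c = 0 := by
  set p := trigPoly F c with hp
  have hsm : IsSmooth (fun x => p x * p x) := by
    have := isSmooth_trigPoly F c
    unfold IsSmooth at this ⊢
    exact this.mul this
  have hd : ∀ j x, partialD j (fun x => p x * p x) x = 2 * (p x * trigPoly F (gradCoef j c) x) := by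
    intro j x
    have h := hasDerivAt_trigPoly F c j x
    refine (h.mul h).deriv.trans ?_
    simp
    ring
  have h := hu.div_free _ hsm
  simp only [hd] at h
  have e : ∀ j, tri (toL2 p) (u j) (trigPoly F (gradCoef j c))
      = ∫ x, p x * (u j x * trigPoly F (gradCoef j c) x) := fun j => by
    refine integral_congr_ae ?_
    filter_upwards [coeFn_toL2 p] with x hx
    rw [hx]
  have hint : ∀ j, Integrable fun x => p x * (u j x * trigPoly F (gradCoef j c) x) := fun j => by
    refine (integrable_mul_continuous (u j) (p * trigPoly F (gradCoef j c))).congr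
      (Eventually.of_forall fun x => ?_)
    simp only [ContinuousMap.mul_apply]
    ring
  rw [transport, e, e, ← integral_add (hint 0) (hint 1)]
  have h2 : ∫ x, (u 0 x * (2 * (p x * trigPoly F (gradCoef 0 c) x))
      + u 1 x * (2 * (p x * trigPoly F (gradCoef 1 c) x)))
      = 2 * ∫ x, (p x * (u 0 x * trigPoly F (gradCoef 0 c) x)
        + p x * (u 1 x * trigPoly F (gradCoef 1 c) x)) := by
    rw [← integral_const_mul]
    congr 1
    ext x
    ring
  rw [h2] at h
  linarith

/-- The advection term almost cancels when tested against the partial Fourier sum: only the tail of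
the Fourier series of `f` contributes. -/
lemma transport_coef_sq_le {w : L2} {u : Fin 2 → L2} (hu : IsBiotSavart w u) {M : ℝ}
    (hM : ∀ j F x, |trigPoly F (coef (u j)) x| ≤ M) (f : L2) (F : Finset (Fin 2 → ℤ)) :
    transport f u F (coef f) ^ 2
      ≤ 2 * (M * ‖f - proj F f‖) ^ 2 * gradSum F (coef f) := by
  have h0 := trigPoly_transport_self hu F (coef f)
  have h1 : transport f u F (coef f) = transport (f - proj F f) u F (coef f) := by
    have := transport_add_left (f - proj F f) (proj F f) u F (coef f)
    rw [sub_add_cancel] at this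
    rw [this, proj, h0, add_zero]
  rw [h1]
  exact sq_le_of_abs_add_le (abs_tri_le_of_trigPoly_le _ _ _ (hM 0))
    (abs_tri_le_of_trigPoly_le _ _ _ (hM 1)) (norm_grad_sq_le F _)

lemma transport_toL2_sq_le {w : L2} {u : Fin 2 → L2} (hu : FourierBiotSavart w u)
    {q : C(Torus, ℝ)} {κ : ℝ} (hq : ∀ x, |q x| ≤ κ) (F : Finset (Fin 2 → ℤ))
    (c : (Fin 2 → ℤ) → Fin 2 → ℝ) :
    transport (toL2 q) u F c ^ 2 ≤ 2 * (κ * ‖w‖) ^ 2 * gradSum F c := by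
  have h : ∀ j p, |tri (toL2 q) (u j) p| ≤ κ * ‖w‖ * ‖toL2 p‖ := fun j p => by
    rw [tri_comm, tri_toL2]
    calc _ ≤ ‖u j‖ * ‖mulC q (toL2 p)‖ := abs_real_inner_le_norm _ _
      _ ≤ ‖w‖ * (κ * ‖toL2 p‖) := mul_le_mul (hu.norm_le j) (norm_mulC_le hq _) (norm_nonneg _)
        (norm_nonneg _)
      _ = _ := by ring
  exact sq_le_of_abs_add_le (h 0 _) (h 1 _) (norm_grad_sq_le F _)

/-- The advection term `∫ f (u · ∇) cos (k · x)` or `∫ f (u · ∇) sin (k · x)`. -/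
def advect (f : L2) (u : Fin 2 → L2) (k : Fin 2 → ℤ) (m : Fin 2) : ℝ :=
  tri f (u 0) ((trigSign m * k 0) • trigC k (1 - m))
    + tri f (u 1) ((trigSign m * k 1) • trigC k (1 - m))

lemma tri_smul_right (f h : L2) (a : ℝ) (p : C(Torus, ℝ)) :
    tri f h (a • p) = a * tri f h p := by
  rw [tri, tri, ← integral_const_mul]
  congr 1
  ext x
  simp
  ring

lemma tri_add_right (f h : L2) (p q : C(Torus, ℝ)) :
    tri f h (p + q) = tri f h p + tri f h q := by
  rw [tri, tri, tri, ← integral_add (integrable_tri _ _ _) (integrable_tri _ _ _)]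
  congr 1
  ext x
  simp
  ring

lemma tri_sum_right {ι : Type*} (f h : L2) (s : Finset ι) (p : ι → C(Torus, ℝ)) :
    tri f h (∑ i ∈ s, p i) = ∑ i ∈ s, tri f h (p i) := by
  classical
  induction s using Finset.induction_on with
  | empty => simp [tri]
  | insert a s ha ih => rw [Finset.sum_insert ha, Finset.sum_insert ha, tri_add_right, ih]

lemma tri_trigPoly (f h : L2) (F : Finset (Fin 2 → ℤ)) (c : (Fin 2 → ℤ) → Fin 2 → ℝ) :
    tri f h (trigPoly F c) = frameSum F (fun k m => c k m * tri f h (trigC k m)) := by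
  simp only [trigPoly, tri_smul_right, tri_sum_right, frameSum]

lemma frameSum_mul_advect (f : L2) (u : Fin 2 → L2) (F : Finset (Fin 2 → ℤ))
    (c : (Fin 2 → ℤ) → Fin 2 → ℝ) :
    frameSum F (fun k m => c k m * advect f u k m) = transport f u F c := by
  rw [transport, tri_trigPoly, tri_trigPoly, ← frameSum_add]
  simp only [frameSum, advect, tri_smul_right, Fin.sum_univ_two, gradCoef, trigSign]
  congr 1
  refine Finset.sum_congr rfl fun k _ => ?_
  simp
  ring

lemma integral_advect (f : L2) (u : Fin 2 → L2) (k : Fin 2 → ℤ) (m : Fin 2) :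
    ∫ x, f x * (u 0 x * partialD 0 (trig k m) x + u 1 x * partialD 1 (trig k m) x)
      = advect f u k m := by
  rw [advect, tri, tri, ← integral_add (integrable_tri _ _ _) (integrable_tri _ _ _)]
  congr 1
  ext x
  simp [partialD_trig]
  ring

lemma integral_mul_laplacian_trig (f : L2) (k : Fin 2 → ℤ) (m : Fin 2) :
    ∫ x, f x * laplacian (trig k m) x = -(waveSq k * coef f k m) := by
  rw [coef, ← integral_const_mul, ← integral_neg]
  congr 1
  ext x
  rw [laplacian_trig]
  ring

lemma vortDrift_trig (ν₁ g : ℝ) (U : H) (u : Fin 2 → L2) (k : Fin 2 → ℤ) (m : Fin 2) :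
    vortDrift ν₁ g U u (trig k m) = advect (vort U) u k m - ν₁ * (waveSq k * coef (vort U) k m)
      - g * (trigSign m * k 0 * coef (temp U) k (1 - m)) := by
  rw [vortDrift, integral_advect, integral_mul_laplacian_trig, integral_mul_partialD_trig]
  ring

lemma tempDrift_trig (ν₂ : ℝ) (U : H) (u : Fin 2 → L2) (k : Fin 2 → ℤ) (m : Fin 2) :
    tempDrift ν₂ U u (trig k m)
      = advect (temp U) u k m - ν₂ * (waveSq k * coef (temp U) k m) := by
  rw [tempDrift, integral_advect, integral_mul_laplacian_trig]
  ring

lemma frameSum_mul_partial (F : Finset (Fin 2 → ℤ)) (c : (Fin 2 → ℤ) → Fin 2 → ℝ) (f : L2) :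
    frameSum F (fun k m => c k m * (trigSign m * k 0 * coef f k (1 - m)))
      = frameSum F (fun k m => gradCoef 0 c k m * coef f k m) := by
  simp only [frameSum, Fin.sum_univ_two, gradCoef, trigSign]
  congr 1
  refine Finset.sum_congr rfl fun k _ => ?_
  simp
  ring

/-! ### The energy inequality at a fixed time -/

lemma abs_le_half_add_of_sq_le {X P Q : ℝ} (hP : 0 ≤ P) (hQ : 0 ≤ Q) (h : X ^ 2 ≤ P * Q) :
    |X| ≤ (P + Q) / 2 := by
  refine abs_le_of_sq_le_sq ?_ (by positivity)
  nlinarith [sq_nonneg (P - Q)]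

/-- Half the rate of change of the energy of the Fourier modes in `F` of `(w, θ - q)`, where `q` is the
value of the noise. -/
def energyRate (ν₁ ν₂ g : ℝ) (U : H) (u : Fin 2 → L2) (q : C(Torus, ℝ))
    (F : Finset (Fin 2 → ℤ)) : ℝ :=
  ν₁ * ν₂ / g ^ 2 * frameSum F (fun k m => coef (vort U) k m * vortDrift ν₁ g U u (trig k m))
    + frameSum F (fun k m => coef (temp U - toL2 q) k m * tempDrift ν₂ U u (trig k m))

/-- The energy of the Fourier modes in `F` of `(w, η)`. -/
def modeEnergy (ν₁ ν₂ g : ℝ) (w η : L2) (F : Finset (Fin 2 → ℤ)) : ℝ :=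
  ν₁ * ν₂ / g ^ 2 * frameSum F (fun k m => coef w k m ^ 2) + frameSum F (fun k m => coef η k m ^ 2)

/-- The weight `ν₁ ν₂ / g²` in the energy is what lets the buoyancy term `g ∂₁ θ` be absorbed by the two
dissipation terms. The remaining contributions are of the order of the noise, or involve tails of
Fourier series. -/
lemma energyRate_le {ν₁ ν₂ g : ℝ} (hν₁ : 0 < ν₁) (hν₂ : 0 < ν₂) (hg : g ≠ 0) {U : H}
    {u : Fin 2 → L2} (hu : IsBiotSavart (vort U) u) {M : ℝ}
    (hM : ∀ j F x, |trigPoly F (coef (u j)) x| ≤ M) {q : C(Torus, ℝ)} {z : L2} {κ : ℝ}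
    (hq : ∀ x, |q x| ≤ κ) (hq2 : ‖toL2 q‖ ≤ κ) (hz : ‖z‖ ≤ κ)
    (hqz : ∀ k m, waveSq k * coef (toL2 q) k m = coef z k m)
    (hw0 : ∀ m, coef (vort U) 0 m = 0) (hη0 : ∀ m, coef (temp U - toL2 q) 0 m = 0)
    (hκ : 4 * κ ^ 2 / ν₂ ≤ ν₁ * ν₂ / g ^ 2 * ν₁ / 8) (F : Finset (Fin 2 → ℤ)) :
    energyRate ν₁ ν₂ g U u q F ≤
      -(min ν₁ ν₂ / 8) * modeEnergy ν₁ ν₂ g (vort U) (temp U - toL2 q) F + 4 * ν₂ * κ ^ 2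
      + 4 * (ν₁ * ν₂ / g ^ 2) / ν₁ * (M * ‖vort U - proj F (vort U)‖) ^ 2
      + 4 / ν₂ * (M * ‖(temp U - toL2 q) - proj F (temp U - toL2 q)‖) ^ 2
      + ν₁ * ν₂ / g ^ 2 * ν₁ / 8 * (‖vort U‖ * ‖vort U - proj F (vort U)‖) := by
  have hlg : ν₁ * ν₂ / g ^ 2 * g ^ 2 = ν₁ * ν₂ := div_mul_cancel₀ _ (pow_ne_zero 2 hg)
  have hlpos : 0 < ν₁ * ν₂ / g ^ 2 := by positivity
  rw [energyRate, modeEnergy]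
  set lam := ν₁ * ν₂ / g ^ 2 with hlam
  set w := vort U with hw
  set η := temp U - toL2 q with hη
  have hθ : temp U = η + toL2 q := by rw [hη, sub_add_cancel]
  set A := frameSum F (fun k m => coef w k m ^ 2) with hA
  set B := frameSum F (fun k m => coef η k m ^ 2) with hB
  set A1 := gradSum F (coef w) with hA1
  set B1 := gradSum F (coef η) with hB1
  have hA1' := gradSum_nonneg F (coef w)
  have hB1' := gradSum_nonneg F (coef η)
  rw [← hA1] at hA1'
  rw [← hB1] at hB1'
  have hB0 : 0 ≤ B := frameSum_nonneg fun _ _ => sq_nonneg _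
  have hAA : A ≤ A1 := frameSum_sq_le_gradSum F hw0
  have hBB : B ≤ B1 := frameSum_sq_le_gradSum F hη0
  have hg2 : frameSum F (fun k m => gradCoef 0 (coef w) k m ^ 2) ≤ A1 := by
    have h1 := frameSum_gradCoef_sq F (coef w)
    have h2 : 0 ≤ frameSum F (fun k m => gradCoef 1 (coef w) k m ^ 2) :=
      frameSum_nonneg fun _ _ => sq_nonneg _
    linarith
  -- the buoyancy term, split according to `θ = η + q`
  set X1 := frameSum F (fun k m => gradCoef 0 (coef w) k m * coef η k m) with hX1
  set X2 := frameSum F (fun k m => gradCoef 0 (coef w) k m * coef (toL2 q) k m) with hX2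
  set X3 := frameSum F (fun k m => coef η k m * coef z k m) with hX3
  have hX1' : X1 ^ 2 ≤ A1 * B :=
    (frameSum_cauchy_schwarz F _ _).trans (mul_le_mul_of_nonneg_right hg2 hB0)
  have hκq : frameSum F (fun k m => coef (toL2 q) k m ^ 2) ≤ κ ^ 2 :=
    (frameSum_coef_sq_le F _).trans (pow_le_pow_left₀ (norm_nonneg _) hq2 2)
  have hκz : frameSum F (fun k m => coef z k m ^ 2) ≤ κ ^ 2 :=
    (frameSum_coef_sq_le F _).trans (pow_le_pow_left₀ (norm_nonneg _) hz 2)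
  have hX2' : X2 ^ 2 ≤ A1 * κ ^ 2 := (frameSum_cauchy_schwarz F _ _).trans
    (mul_le_mul hg2 hκq (frameSum_nonneg fun _ _ => sq_nonneg _) hA1')
  have hX3' : X3 ^ 2 ≤ B * κ ^ 2 :=
    (frameSum_cauchy_schwarz F _ _).trans (mul_le_mul_of_nonneg_left hκz hB0)
  set r := M * ‖w - proj F w‖ with hr
  set r' := M * ‖η - proj F η‖ with hr'
  have hTw := transport_coef_sq_le hu hM w F
  have hTη := transport_coef_sq_le hu hM η F
  have hTq := transport_toL2_sq_le hu.fourier hq F (coef η)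
  set Tw := transport w u F (coef w) with hTw'
  set Tη := transport η u F (coef η) with hTη'
  set Tq := transport (toL2 q) u F (coef η) with hTq'
  have e1 : frameSum F (fun k m => coef w k m * vortDrift ν₁ g U u (trig k m))
      = Tw - ν₁ * A1 - g * (X1 + X2) := by
    have h : ∀ k m, coef w k m * vortDrift ν₁ g U u (trig k m)
        = coef w k m * advect w u k m + (-ν₁ * (waveSq k * coef w k m ^ 2)
          + -g * (coef w k m * (trigSign m * k 0 * coef (temp U) k (1 - m)))) := by
      intro k m
      rw [vortDrift_trig]
      ring
    simp only [h, frameSum_add, frameSum_mul_left, frameSum_mul_advect, frameSum_mul_partial]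
    simp only [hθ, coef_add, mul_add, frameSum_add]
    rw [← hX1, ← hX2, hA1, gradSum]
    ring
  have e2 : frameSum F (fun k m => coef η k m * tempDrift ν₂ U u (trig k m))
      = Tη + Tq - ν₂ * B1 - ν₂ * X3 := by
    have h : ∀ k m, coef η k m * tempDrift ν₂ U u (trig k m)
        = coef η k m * advect (temp U) u k m + (-ν₂ * (waveSq k * coef η k m ^ 2)
          + -ν₂ * (coef η k m * coef z k m)) := by
      intro k m
      rw [tempDrift_trig, ← hqz, hθ, coef_add]
      ring
    simp only [h, frameSum_add, frameSum_mul_left, frameSum_mul_advect]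
    rw [hθ, transport_add_left, ← hX3, hB1, gradSum]
    ring
  rw [e1, e2]
  -- Young's inequality for each term
  have y1 : |lam * g * X1| ≤ (lam * ν₁ * A1 + ν₂ * B) / 2 := by
    refine abs_le_half_add_of_sq_le (by positivity) (by positivity) ?_
    calc (lam * g * X1) ^ 2 = lam * (lam * g ^ 2) * X1 ^ 2 := by ring
      _ ≤ lam * (lam * g ^ 2) * (A1 * B) := mul_le_mul_of_nonneg_left hX1' (by positivity)
      _ = _ := by rw [hlg]; ring
  have y2 : |lam * g * X2| ≤ (lam * ν₁ * A1 / 4 + 4 * ν₂ * κ ^ 2) / 2 := by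
    refine abs_le_half_add_of_sq_le (by positivity) (by positivity) ?_
    calc (lam * g * X2) ^ 2 = lam * (lam * g ^ 2) * X2 ^ 2 := by ring
      _ ≤ lam * (lam * g ^ 2) * (A1 * κ ^ 2) := mul_le_mul_of_nonneg_left hX2' (by positivity)
      _ = _ := by rw [hlg]; ring
  have y3 : |ν₂ * X3| ≤ (ν₂ * B / 4 + 4 * ν₂ * κ ^ 2) / 2 := by
    refine abs_le_half_add_of_sq_le (by positivity) (by positivity) ?_
    calc (ν₂ * X3) ^ 2 = ν₂ ^ 2 * X3 ^ 2 := by ring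
      _ ≤ ν₂ ^ 2 * (B * κ ^ 2) := mul_le_mul_of_nonneg_left hX3' (by positivity)
      _ = _ := by ring
  have y4 : |lam * Tw| ≤ (lam * ν₁ * A1 / 4 + 8 * lam / ν₁ * r ^ 2) / 2 := by
    refine abs_le_half_add_of_sq_le (by positivity) (by positivity) ?_
    calc (lam * Tw) ^ 2 = lam ^ 2 * Tw ^ 2 := by ring
      _ ≤ lam ^ 2 * (2 * r ^ 2 * A1) := mul_le_mul_of_nonneg_left hTw (by positivity)
      _ = _ := by field_simp; ring
  have y5 : |Tη| ≤ (ν₂ * B1 / 4 + 8 / ν₂ * r' ^ 2) / 2 := by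
    refine abs_le_half_add_of_sq_le (by positivity) (by positivity) (hTη.trans_eq ?_)
    field_simp
    ring
  have y6 : |Tq| ≤ (ν₂ * B1 / 4 + 8 / ν₂ * (κ * ‖w‖) ^ 2) / 2 := by
    refine abs_le_half_add_of_sq_le (by positivity) (by positivity) (hTq.trans_eq ?_)
    field_simp
    ring
  have y7 : 4 / ν₂ * (κ * ‖w‖) ^ 2 ≤ lam * ν₁ / 8 * (A1 + ‖w‖ * ‖w - proj F w‖) := by
    have h1 := norm_sq_sub_frameSum_le F w
    calc 4 / ν₂ * (κ * ‖w‖) ^ 2 = 4 * κ ^ 2 / ν₂ * ‖w‖ ^ 2 := by ring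
      _ ≤ lam * ν₁ / 8 * ‖w‖ ^ 2 := mul_le_mul_of_nonneg_right hκ (sq_nonneg _)
      _ ≤ _ := mul_le_mul_of_nonneg_left (by linarith) (by positivity)
  have y8 : min ν₁ ν₂ * (lam * A) ≤ ν₁ * (lam * A1) :=
    mul_le_mul (min_le_left _ _) (mul_le_mul_of_nonneg_left hAA hlpos.le)
      (mul_nonneg hlpos.le (frameSum_nonneg fun _ _ => sq_nonneg _)) hν₁.le
  have y9 : min ν₁ ν₂ * B ≤ ν₂ * B1 := mul_le_mul (min_le_right _ _) hBB hB0 hν₂.le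
  have y10 : ν₂ * B ≤ ν₂ * B1 := mul_le_mul_of_nonneg_left hBB hν₂.le
  have z1 := neg_le_of_abs_le y1
  have z2 := neg_le_of_abs_le y2
  have z3 := neg_le_of_abs_le y3
  have z4 := le_of_abs_le y4
  have z5 := le_of_abs_le y5
  have z6 := le_of_abs_le y6
  have t1 : 8 * lam / ν₁ * r ^ 2 = 2 * (4 * lam / ν₁ * r ^ 2) := by ring
  have t2 : 8 / ν₂ * r' ^ 2 = 2 * (4 / ν₂ * r' ^ 2) := by ring
  have t3 : 8 / ν₂ * (κ * ‖w‖) ^ 2 = 2 * (4 / ν₂ * (κ * ‖w‖) ^ 2) := by ring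
  rw [t1] at z4
  rw [t2] at z5
  rw [t3] at z6
  linarith

/-! ### The noise as a trigonometric polynomial -/

/-- The trigonometric polynomial `∑ a_i trig_i` over the noise directions. -/
def noisePoly (Z : Finset (Fin 2 → ℤ)) (a : NoiseIndex Z → ℝ) : C(Torus, ℝ) :=
  ∑ i, a i • trigC i.1 i.2

lemma noisePoly_apply (Z : Finset (Fin 2 → ℤ)) (a : NoiseIndex Z → ℝ) (x : Torus) :
    noisePoly Z a x = ∑ i, a i * trig i.1 i.2 x := by
  simp [noisePoly]

lemma coef_toL2_noisePoly (Z : Finset (Fin 2 → ℤ)) (a : NoiseIndex Z → ℝ) (k : Fin 2 → ℤ)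
    (m : Fin 2) : coef (toL2 (noisePoly Z a)) k m
      = ∑ i, a i * coef (toL2 (trigC i.1 i.2)) k m := by
  simp only [noisePoly, toL2_sum, toL2_smul, coef_eq_inner, inner_sum, inner_smul_right]

lemma coef_toL2 (p : C(Torus, ℝ)) (k : Fin 2 → ℤ) (m : Fin 2) :
    coef (toL2 p) k m = ∫ x, p x * trig k m x := by
  refine integral_congr_ae ?_
  filter_upwards [coeFn_toL2 p] with x hx
  rw [hx]

lemma forcing_trig (Z : Finset (Fin 2 → ℤ)) (α l : NoiseIndex Z → ℝ) (k : Fin 2 → ℤ)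
    (m : Fin 2) : forcing Z α l (trig k m)
      = coef (toL2 (noisePoly Z fun i => α i * l i)) k m := by
  rw [coef_toL2_noisePoly, forcing]
  refine Finset.sum_congr rfl fun i _ => ?_
  rw [coef_toL2]
  simp only [trigC_apply]
  ring

lemma integral_trig {k : Fin 2 → ℤ} (hk : k ≠ 0) (m : Fin 2) : ∫ x, trig k m x = 0 := by
  have hi : Integrable (fun x => torusChar k x) (volume : Measure Torus) :=
    (torusChar k).continuous.integrable_of_hasCompactSupport
      (HasCompactSupport.of_compactSpace _)
  fin_cases m
  · simp only [Fin.zero_eta, trig_zero_eq]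
    exact (Complex.reCLM.integral_comp_comm hi).trans (by simp [integral_torusChar hk])
  · simp only [Fin.mk_one, trig_one_eq]
    exact (Complex.imCLM.integral_comp_comm hi).trans (by simp [integral_torusChar hk])

lemma integral_trig_mul_trig {k l : Fin 2 → ℤ} (h1 : k ≠ l) (h2 : k ≠ -l) (m n : Fin 2) :
    ∫ x, trig k m x * trig l n x = 0 := by
  have hs : k + -l ≠ 0 := by rwa [← sub_eq_add_neg, sub_ne_zero]
  have ha : k + l ≠ 0 := by rwa [Ne, add_eq_zero_iff_eq_neg]
  -- product-to-sum formulas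
  have key : ∃ a b : ℝ, ∃ i : Fin 2, ∀ x,
      trig k m x * trig l n x = a * trig (k + -l) i x + b * trig (k + l) i x := by
    fin_cases m <;> fin_cases n
    · refine ⟨1 / 2, 1 / 2, 0, fun x => ?_⟩
      simp [trig_zero_eq, torusChar_add, torusChar_neg]
      ring
    · refine ⟨-1 / 2, 1 / 2, 1, fun x => ?_⟩
      simp [trig_zero_eq, trig_one_eq, torusChar_add, torusChar_neg]
      ring
    · refine ⟨1 / 2, 1 / 2, 1, fun x => ?_⟩
      simp [trig_zero_eq, trig_one_eq, torusChar_add, torusChar_neg]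
      ring
    · refine ⟨1 / 2, -1 / 2, 0, fun x => ?_⟩
      simp [trig_zero_eq, trig_one_eq, torusChar_add, torusChar_neg]
      ring
  obtain ⟨a, b, i, h⟩ := key
  have hi : ∀ k' : Fin 2 → ℤ, Integrable (trig k' i) (volume : Measure Torus) := fun k' =>
    (trigC k' i).continuous.integrable_of_hasCompactSupport (HasCompactSupport.of_compactSpace _)
  simp only [h]
  rw [integral_add ((hi _).const_mul a) ((hi _).const_mul b), integral_const_mul,
    integral_const_mul, integral_trig hs, integral_trig ha]
  simp

lemma waveSq_mul_coef_trig (k l : Fin 2 → ℤ) (m n : Fin 2) :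
    waveSq k * coef (toL2 (trigC l n)) k m = waveSq l * coef (toL2 (trigC l n)) k m := by
  by_cases h1 : l = k
  · rw [h1]
  by_cases h2 : l = -k
  · simp [h2, waveSq]
  · rw [coef_toL2]
    simp only [trigC_apply]
    rw [integral_trig_mul_trig h1 h2]
    simp

lemma waveSq_mul_coef_noisePoly (Z : Finset (Fin 2 → ℤ)) (a : NoiseIndex Z → ℝ)
    (k : Fin 2 → ℤ) (m : Fin 2) :
    waveSq k * coef (toL2 (noisePoly Z a)) k m
      = coef (toL2 (noisePoly Z fun i => waveSq i.1 * a i)) k m := by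
  rw [coef_toL2_noisePoly, coef_toL2_noisePoly, Finset.mul_sum]
  refine Finset.sum_congr rfl fun i _ => ?_
  have := waveSq_mul_coef_trig k i.1 m i.2
  linear_combination a i * this

lemma abs_noisePoly_le (Z : Finset (Fin 2 → ℤ)) (a : NoiseIndex Z → ℝ) (x : Torus) :
    |noisePoly Z a x| ≤ ∑ i, |a i| := by
  rw [noisePoly_apply]
  refine (Finset.abs_sum_le_sum_abs _ _).trans (Finset.sum_le_sum fun i _ => ?_)
  rw [abs_mul]
  exact mul_le_of_le_one_right (abs_nonneg _) (abs_trig_le _ _ x)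

lemma norm_toL2_le {p : C(Torus, ℝ)} {M : ℝ} (hp : ∀ x, |p x| ≤ M) :
    ‖toL2 p‖ ≤ M * ‖toL2 1‖ := by
  refine Lp.norm_le_mul_norm_of_ae_le_mul ?_
  filter_upwards [coeFn_toL2 p, coeFn_toL2 1] with x h1 h2
  rw [h1, h2]
  simpa using hp x

lemma norm_noisePoly_sub_proj_le (Z : Finset (Fin 2 → ℤ)) (a b : NoiseIndex Z → ℝ)
    (hab : ∀ i, |a i| ≤ b i) (F : Finset (Fin 2 → ℤ)) :
    ‖toL2 (noisePoly Z a) - proj F (toL2 (noisePoly Z a))‖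
      ≤ ∑ i, b i * ‖toL2 (trigC i.1 i.2) - proj F (toL2 (trigC i.1 i.2))‖ := by
  have h : toL2 (noisePoly Z a) - proj F (toL2 (noisePoly Z a))
      = ∑ i, a i • (toL2 (trigC i.1 i.2) - proj F (toL2 (trigC i.1 i.2))) := by
    simp only [smul_sub, Finset.sum_sub_distrib]
    congr 1
    · simp only [noisePoly, toL2_sum, toL2_smul]
    · have hadd : ∀ s : Finset (NoiseIndex Z), proj F (∑ i ∈ s, a i • toL2 (trigC i.1 i.2))
          = ∑ i ∈ s, a i • proj F (toL2 (trigC i.1 i.2)) := by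
        classical
        intro s
        induction s using Finset.induction_on with
        | empty => simp [proj, toL2_trigPoly, coef_eq_inner]
        | insert i s hi ih =>
          rw [Finset.sum_insert hi, Finset.sum_insert hi, proj_add, ih]
          congr 1
          simp only [proj, toL2_trigPoly, coef_eq_inner, inner_smul_right, Finset.smul_sum,
            smul_smul]
          refine Finset.sum_congr rfl fun k _ => Finset.sum_congr rfl fun m _ => ?_
          congr 1
          ring
      rw [← hadd]
      simp only [noisePoly, toL2_sum, toL2_smul]
  rw [h]
  refine (norm_sum_le _ _).trans (Finset.sum_le_sum fun i _ => ?_)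
  rw [norm_smul]
  exact mul_le_mul_of_nonneg_right (hab i) (norm_nonneg _)

/-! ### Right-continuous paths -/

lemma measurable_of_rightContinuous {f : ℝ → ℝ} (hf : ∀ t, ContinuousWithinAt f (Ici t) t) :
    Measurable f := by
  -- `f` is the limit of its values at the grid points to the right
  refine measurable_of_tendsto_metrizable 
    (f := fun (n : ℕ) (t : ℝ) => f (⌈t * ((n : ℝ) + 1)⌉ / ((n : ℝ) + 1)))
    (fun n => ?_) (tendsto_pi_nhds.2 fun t => ?_)
  · have h1 : Measurable (fun z : ℤ => f (z / ((n : ℝ) + 1))) := measurable_from_top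
    exact h1.comp (Int.measurable_ceil.comp (measurable_id.mul_const _))
  · have hpos : ∀ n : ℕ, (0 : ℝ) < n + 1 := fun n => by positivity
    have hlow : ∀ n : ℕ, t ≤ ⌈t * (n + 1)⌉ / ((n : ℝ) + 1) := fun n => by
      rw [le_div_iff₀ (hpos n)]
      exact Int.le_ceil _
    have hup : ∀ n : ℕ, ⌈t * (n + 1)⌉ / ((n : ℝ) + 1) ≤ t + 1 / ((n : ℝ) + 1) := fun n => by
      rw [div_le_iff₀ (hpos n), add_mul, div_mul_cancel₀ _ (hpos n).ne']
      exact (Int.ceil_lt_add_one _).le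
    refine Tendsto.comp (hf t) (tendsto_nhdsWithin_iff.2 ⟨?_, Eventually.of_forall hlow⟩)
    refine tendsto_of_tendsto_of_tendsto_of_le_of_le tendsto_const_nhds ?_ hlow hup
    simpa using (tendsto_const_nhds (x := t)).add
      (tendsto_one_div_add_atTop_nhds_zero_nat (𝕜 := ℝ))

lemma exists_bound_of_cadlag {U : ℝ≥0 → H} (hr : ∀ t, ContinuousWithinAt U (Ici t) t)
    (hl : ∀ t, ∃ V : H, Tendsto U (𝓝[<] t) (𝓝 V)) (T : ℝ≥0) :
    ∃ M : ℝ, ∀ t ≤ T, ‖U t‖ ≤ M := by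
  have h : ∃ M : ℝ, ∀ t ∈ Icc 0 T, ‖U t‖ ≤ M := by
    refine (isCompact_Icc (a := (0 : ℝ≥0)) (b := T)).induction_on
      (p := fun s => ∃ M : ℝ, ∀ t ∈ s, ‖U t‖ ≤ M) ⟨0, by simp⟩ ?_ ?_ ?_
    · rintro s t hst ⟨M, hM⟩
      exact ⟨M, fun x hx => hM x (hst hx)⟩
    · rintro s t ⟨M, hM⟩ ⟨N, hN⟩
      exact ⟨max M N, fun x hx => hx.elim (fun h => (hM x h).trans (le_max_left _ _))
        (fun h => (hN x h).trans (le_max_right _ _))⟩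
    · intro t _
      obtain ⟨V, hV⟩ := hl t
      have h1 : ∀ᶠ s in 𝓝[<] t, ‖U s‖ ≤ ‖V‖ + 1 :=
        (hV.norm.eventually (gt_mem_nhds (lt_add_one _))).mono fun _ h => h.le
      have h2 : ∀ᶠ s in 𝓝[≥] t, ‖U s‖ ≤ ‖U t‖ + 1 :=
        ((hr t).norm.eventually (gt_mem_nhds (lt_add_one _))).mono fun _ h => h.le
      have h3 : ∀ᶠ s in 𝓝 t, ‖U s‖ ≤ max (‖V‖ + 1) (‖U t‖ + 1) := by
        rw [← nhdsLT_sup_nhdsGE, eventually_sup]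
        exact ⟨h1.mono fun _ h => h.trans (le_max_left _ _),
          h2.mono fun _ h => h.trans (le_max_right _ _)⟩
      exact ⟨_, nhdsWithin_le_nhds h3, _, fun x hx => hx⟩
  obtain ⟨M, hM⟩ := h
  exact ⟨M, fun t ht => hM t ⟨zero_le, ht⟩⟩

lemma continuous_mulC (p : C(Torus, ℝ)) : Continuous (mulC p) := by
  have hsub : ∀ f h, mulC p f - mulC p h = mulC p (f - h) := fun f h => by
    refine Lp.ext ?_
    filter_upwards [Lp.coeFn_sub (mulC p f) (mulC p h), coeFn_mulC p f, coeFn_mulC p h,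
      coeFn_mulC p (f - h), Lp.coeFn_sub f h] with x h1 h2 h3 h4 h5
    rw [h1, Pi.sub_apply, h2, h3, h4, h5, Pi.sub_apply, mul_sub]
  refine LipschitzWith.continuous (K := ⟨‖p‖, norm_nonneg _⟩)
    (LipschitzWith.of_dist_le_mul fun f h => ?_)
  rw [dist_eq_norm, dist_eq_norm, hsub]
  exact norm_mulC_le p.norm_coe_le_norm _

lemma continuousWithinAt_tri {s : Set ℝ} {t : ℝ} {f h : ℝ → L2} (hf : ContinuousWithinAt f s t)
    (hh : ContinuousWithinAt h s t) (p : C(Torus, ℝ)) :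
    ContinuousWithinAt (fun r => tri (f r) (h r) p) s t := by
  simp only [tri_eq_inner]
  exact hf.inner ((continuous_mulC p).continuousAt.comp_continuousWithinAt hh)

lemma continuousWithinAt_advect {s : Set ℝ} {t : ℝ} {f : ℝ → L2} {u : ℝ → Fin 2 → L2}
    (hf : ContinuousWithinAt f s t) (hu : ∀ j, ContinuousWithinAt (fun r => u r j) s t)
    (k : Fin 2 → ℤ) (m : Fin 2) : ContinuousWithinAt (fun r => advect (f r) (u r) k m) s t :=
  (continuousWithinAt_tri hf (hu 0) _).add (continuousWithinAt_tri hf (hu 1) _)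

lemma abs_advect_le {w : L2} {u : Fin 2 → L2} (hu : FourierBiotSavart w u) (f : L2)
    (k : Fin 2 → ℤ) (m : Fin 2) :
    |advect f u k m| ≤ (|(k 0 : ℝ)| + |(k 1 : ℝ)|) * ‖f‖ * ‖w‖ := by
  have h : ∀ j, |tri f (u j) ((trigSign m * k j) • trigC k (1 - m))|
      ≤ |(k j : ℝ)| * ‖f‖ * ‖w‖ := fun j => by
    refine (abs_tri_le (M := |(k j : ℝ)|) f (u j) fun x => ?_).trans
      (mul_le_mul_of_nonneg_left (hu.norm_le j) (by positivity))
    have hs : |trigSign m| = 1 := by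
      unfold trigSign
      split_ifs <;> simp
    simp only [ContinuousMap.smul_apply, smul_eq_mul, abs_mul, hs, one_mul, trigC_apply]
    exact mul_le_of_le_one_right (abs_nonneg _) (abs_trig_le _ _ x)
  refine (abs_add_le _ _).trans ((add_le_add (h 0) (h 1)).trans_eq ?_)
  ring

lemma abs_coef_le (f : L2) (k : Fin 2 → ℤ) (m : Fin 2) : |coef f k m| ≤ ‖toL2 1‖ * ‖f‖ := by
  rw [coef_eq_inner]
  refine (abs_real_inner_le_norm _ _).trans (mul_le_mul_of_nonneg_right ?_ (norm_nonneg _))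
  simpa using norm_toL2_le (p := trigC k m) (abs_trig_le k m)

/-! ### Evolution of the energy of finitely many modes -/

lemma IsPathSolution.vort_temp_right_cont {ν₁ ν₂ g : ℝ} {Z : Finset (Fin 2 → ℤ)}
    {α : NoiseIndex Z → ℝ} {L : ℝ≥0 → NoiseIndex Z → ℝ} {U₀ : H} {U : ℝ≥0 → H}
    (h : IsPathSolution ν₁ ν₂ g Z α L U₀ U) (t : ℝ) :
    ContinuousWithinAt (fun s : ℝ => vort (U s.toNNReal)) (Ici t) t ∧
      ContinuousWithinAt (fun s : ℝ => temp (U s.toNNReal)) (Ici t) t := by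
  have h1 : ContinuousWithinAt (fun s : ℝ => U s.toNNReal) (Ici t) t :=
    (h.right_cont t.toNNReal).comp continuous_real_toNNReal.continuousWithinAt
      fun s hs => Real.toNNReal_le_toNNReal hs
  exact ⟨(continuous_fst.comp continuous_subtype_val).continuousAt.comp_continuousWithinAt h1,
    (continuous_snd.comp continuous_subtype_val).continuousAt.comp_continuousWithinAt h1⟩

lemma IsPathSolution.exists_bound {ν₁ ν₂ g : ℝ} {Z : Finset (Fin 2 → ℤ)}
    {α : NoiseIndex Z → ℝ} {L : ℝ≥0 → NoiseIndex Z → ℝ} {U₀ : H} {U : ℝ≥0 → H}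
    (h : IsPathSolution ν₁ ν₂ g Z α L U₀ U) (T : ℝ≥0) :
    ∃ N : ℝ, ∀ s : ℝ, s ≤ T → ‖vort (U s.toNNReal)‖ ≤ N ∧ ‖temp (U s.toNNReal)‖ ≤ N := by
  obtain ⟨N, hN⟩ := exists_bound_of_cadlag h.right_cont h.left_lim T
  refine ⟨N, fun s hs => ?_⟩
  have h1 := hN s.toNNReal (Real.toNNReal_le_iff_le_coe.2 hs)
  exact ⟨(norm_fst_le (U s.toNNReal).1).trans h1, (norm_snd_le (U s.toNNReal).1).trans h1⟩

lemma continuousWithinAt_velocity {w : ℝ → L2} {u : ℝ → Fin 2 → L2} {S : Set ℝ} {t : ℝ}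
    (hu : ∀ s, FourierBiotSavart (w s) (u s)) (hw : ContinuousWithinAt w S t) (j : Fin 2) :
    ContinuousWithinAt (fun s => u s j) S t := by
  have h0 : Tendsto (fun s => ‖w s - w t‖) (𝓝[S] t) (𝓝 0) :=
    tendsto_iff_norm_sub_tendsto_zero.1 hw
  exact tendsto_iff_norm_sub_tendsto_zero.2 (squeeze_zero (fun _ => norm_nonneg _)
    (fun s => ((hu s).sub (hu t)).norm_le j) h0)

lemma continuousWithinAt_coef {f : ℝ → L2} {S : Set ℝ} {t : ℝ} (hf : ContinuousWithinAt f S t)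
    (k : Fin 2 → ℤ) (m : Fin 2) : ContinuousWithinAt (fun s => coef (f s) k m) S t :=
  (continuous_coef k m).continuousAt.comp_continuousWithinAt hf

lemma intervalIntegrable_of_rightContinuous {d : ℝ → ℝ}
    (hd : ∀ t, ContinuousWithinAt d (Ici t) t) {T : ℝ} (hT : 0 ≤ T) {N : ℝ}
    (hN : ∀ s ≤ T, |d s| ≤ N) : IntervalIntegrable d volume 0 T := by
  rw [intervalIntegrable_iff_integrableOn_Ioc_of_le hT]
  refine Measure.integrableOn_of_bounded (M := N) (by simp)
    (measurable_of_rightContinuous hd).aestronglyMeasurable ?_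
  filter_upwards [ae_restrict_mem measurableSet_Ioc] with s hs
  exact hN s hs.2

/-- Tested against a fixed trigonometric function, both drifts are right-continuous and locally
bounded in time. In particular they are integrable, so that the time integrals in the definition of
a solution have their intended meaning. -/
lemma IsPathSolution.drift_regular {ν₁ ν₂ g : ℝ} {Z : Finset (Fin 2 → ℤ)}
    {α : NoiseIndex Z → ℝ} {L : ℝ≥0 → NoiseIndex Z → ℝ} {U₀ : H} {U : ℝ≥0 → H}
    (h : IsPathSolution ν₁ ν₂ g Z α L U₀ U) {u : ℝ≥0 → Fin 2 → L2}
    (hu : ∀ t, IsBiotSavart (vort (U t)) (u t)) (k : Fin 2 → ℤ) (m : Fin 2) :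
    ((∀ t, ContinuousWithinAt (fun s : ℝ =>
        vortDrift ν₁ g (U s.toNNReal) (u s.toNNReal) (trig k m)) (Ici t) t) ∧
      ∀ T : ℝ≥0, IntervalIntegrable (fun s : ℝ =>
        vortDrift ν₁ g (U s.toNNReal) (u s.toNNReal) (trig k m)) volume 0 T) ∧
    ((∀ t, ContinuousWithinAt (fun s : ℝ =>
        tempDrift ν₂ (U s.toNNReal) (u s.toNNReal) (trig k m)) (Ici t) t) ∧
      ∀ T : ℝ≥0, IntervalIntegrable (fun s : ℝ =>
        tempDrift ν₂ (U s.toNNReal) (u s.toNNReal) (trig k m)) volume 0 T) := by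
  have hu' : ∀ s : ℝ, FourierBiotSavart (vort (U s.toNNReal)) (u s.toNNReal) :=
    fun s => (hu _).fourier
  have hw := fun t => (h.vort_temp_right_cont t).1
  have hθ := fun t => (h.vort_temp_right_cont t).2
  have huc := fun t j => continuousWithinAt_velocity hu' (hw t) j
  have c1 : ∀ t, ContinuousWithinAt (fun s : ℝ =>
      vortDrift ν₁ g (U s.toNNReal) (u s.toNNReal) (trig k m)) (Ici t) t := fun t => by
    simp only [vortDrift_trig]
    exact ((continuousWithinAt_advect (hw t) (huc t) k m).sub
      ((((continuousWithinAt_coef (hw t) k m).const_mul _)).const_mul _)).sub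
      (((continuousWithinAt_coef (hθ t) k (1 - m)).const_mul _).const_mul _)
  have c2 : ∀ t, ContinuousWithinAt (fun s : ℝ =>
      tempDrift ν₂ (U s.toNNReal) (u s.toNNReal) (trig k m)) (Ici t) t := fun t => by
    simp only [tempDrift_trig]
    exact (continuousWithinAt_advect (hθ t) (huc t) k m).sub
      ((((continuousWithinAt_coef (hθ t) k m).const_mul _)).const_mul _)
  refine ⟨⟨c1, fun T => ?_⟩, ⟨c2, fun T => ?_⟩⟩
  all_goals
    obtain ⟨N, hN⟩ := h.exists_bound T
    have hN0 : 0 ≤ N := (norm_nonneg _).trans (hN T le_rfl).1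
    have hadv : ∀ (s : ℝ) (f : L2), s ≤ T → ‖f‖ ≤ N → |advect f (u s.toNNReal) k m|
        ≤ (|(k 0 : ℝ)| + |(k 1 : ℝ)|) * N * N := fun s f hs hf =>
      (abs_advect_le (hu' s) f k m).trans (by have := (hN s hs).1; gcongr)
    have hcoef : ∀ (f : L2) (m : Fin 2), ‖f‖ ≤ N → |coef f k m| ≤ ‖toL2 1‖ * N := fun f m hf =>
      (abs_coef_le f k m).trans (by gcongr)
  · refine intervalIntegrable_of_rightContinuous c1 T.coe_nonneg
      (N := (|(k 0 : ℝ)| + |(k 1 : ℝ)|) * N * N + |ν₁| * (|waveSq k| * (‖toL2 1‖ * N))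
        + |g| * (|trigSign m * k 0| * (‖toL2 1‖ * N))) fun s hs => ?_
    rw [vortDrift_trig]
    refine (abs_sub _ _).trans (add_le_add ((abs_sub _ _).trans (add_le_add
      (hadv s _ hs (hN s hs).1) ?_)) ?_)
    · rw [abs_mul, abs_mul]
      gcongr
      exact hcoef _ _ (hN s hs).1
    · rw [abs_mul, abs_mul (trigSign m * k 0)]
      gcongr
      exact hcoef _ _ (hN s hs).2
  · refine intervalIntegrable_of_rightContinuous c2 T.coe_nonneg
      (N := (|(k 0 : ℝ)| + |(k 1 : ℝ)|) * N * N + |ν₂| * (|waveSq k| * (‖toL2 1‖ * N)))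
      fun s hs => ?_
    rw [tempDrift_trig]
    refine (abs_sub _ _).trans (add_le_add (hadv s _ hs (hN s hs).2) ?_)
    rw [abs_mul, abs_mul]
    gcongr
    exact hcoef _ _ (hN s hs).2

lemma continuousOn_primitive {f₀ T : ℝ} {d : ℝ → ℝ} (hT : 0 ≤ T)
    (hint : IntervalIntegrable d volume 0 T) :
    ContinuousOn (fun s => f₀ + ∫ r in (0 : ℝ)..s, d r) (Icc 0 T) := by
  have h := intervalIntegral.continuousOn_primitive_interval' hint left_mem_uIcc
  rw [uIcc_of_le hT] at h
  exact continuousOn_const.add h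

/-- The chain rule `d(f²) = 2 f f' dt` for the primitive of a right-continuous function. -/
lemma integral_two_mul_primitive_mul {f₀ T t : ℝ} {d : ℝ → ℝ} (ht : t ∈ Icc 0 T)
    (hd : ∀ t, ContinuousWithinAt d (Ici t) t) (hint : IntervalIntegrable d volume 0 T) :
    IntervalIntegrable (fun s => 2 * ((f₀ + ∫ r in (0 : ℝ)..s, d r) * d s)) volume t T ∧
    ∫ s in t..T, 2 * ((f₀ + ∫ r in (0 : ℝ)..s, d r) * d s)
      = (f₀ + ∫ r in (0 : ℝ)..T, d r) ^ 2 - (f₀ + ∫ r in (0 : ℝ)..t, d r) ^ 2 := by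
  have hT : 0 ≤ T := ht.1.trans ht.2
  have hc := continuousOn_primitive (f₀ := f₀) hT hint
  have hsub : uIcc t T ⊆ Icc 0 T := by
    rw [uIcc_of_le ht.2]
    exact Icc_subset_Icc_left ht.1
  have hint' : IntervalIntegrable d volume t T := hint.mono_set (by
    rw [uIcc_of_le hT]
    exact hsub)
  have hi : IntervalIntegrable (fun s => 2 * ((f₀ + ∫ r in (0 : ℝ)..s, d r) * d s)) volume t T :=
    (hint'.continuousOn_mul (hc.mono hsub)).const_mul 2
  refine ⟨hi, intervalIntegral.integral_eq_sub_of_hasDeriv_right ((hc.mono hsub).pow 2) ?_ hi⟩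
  intro s hs
  rw [min_eq_left ht.2, max_eq_right ht.2] at hs
  have hints : IntervalIntegrable d volume 0 s := hint.mono_set (by
    rw [uIcc_of_le hT, uIcc_of_le (ht.1.trans hs.1.le)]
    exact Icc_subset_Icc_right hs.2.le)
  have h1 : HasDerivWithinAt (fun s => f₀ + ∫ r in (0 : ℝ)..s, d r) (d s) (Ici s) s :=
    (intervalIntegral.integral_hasDerivWithinAt_right hints (t := Ioi s)
      ((measurable_of_rightContinuous hd).stronglyMeasurable.stronglyMeasurableAtFilter)
      ((hd s).mono Ioi_subset_Ici_self)).const_add f₀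
  have h2 := (h1.mono Ioi_subset_Ici_self).pow 2
  convert! h2 using 1
  simp
  ring

lemma frameSum_integral (F : Finset (Fin 2 → ℤ)) {φ : (Fin 2 → ℤ) → Fin 2 → ℝ → ℝ} {a b : ℝ}
    (h : ∀ k m, IntervalIntegrable (φ k m) volume a b) :
    IntervalIntegrable (fun s => frameSum F fun k m => φ k m s) volume a b ∧
    ∫ s in a..b, frameSum F (fun k m => φ k m s) = frameSum F fun k m => ∫ s in a..b, φ k m s := by
  have h1 : ∀ k, IntervalIntegrable (fun s => ∑ m : Fin 2, φ k m s) volume a b := fun k => by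
    have := IntervalIntegrable.sum (Finset.univ : Finset (Fin 2)) (f := φ k) fun m _ => h k m
    simpa only [Finset.sum_fn] using this
  have h2 : IntervalIntegrable (fun s => ∑ k ∈ F, ∑ m : Fin 2, φ k m s) volume a b := by
    have := IntervalIntegrable.sum F (f := fun k s => ∑ m : Fin 2, φ k m s) fun k _ => h1 k
    simpa only [Finset.sum_fn] using this
  refine ⟨h2.const_mul _, ?_⟩
  simp only [frameSum]
  rw [intervalIntegral.integral_const_mul,
    intervalIntegral.integral_finsetSum fun k _ => h1 k]
  congr 1
  exact Finset.sum_congr rfl fun k _ => intervalIntegral.integral_finsetSum fun m _ => h k m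

/-- A dissipative integral inequality forces the energy to be small at the final time: either it
falls below `ρ` at some time, after which it grows by little, or it decreases linearly throughout. -/
lemma energy_final_le {E R err : ℝ → ℝ} {T b c ρ : ℝ} (hT : 0 ≤ T) (hb : 0 ≤ b) (hc : 0 ≤ c)
    (hρ : 0 ≤ ρ) (hE0 : ∀ t, 0 ≤ E t) (herr0 : ∀ t, 0 ≤ err t)
    (hER : ∀ t ∈ Icc 0 T, IntervalIntegrable R volume t T ∧ ∫ s in t..T, R s = E T - E t)
    (herr : IntervalIntegrable err volume 0 T)
    (hle : ∀ᵐ s ∂(volume.restrict (Icc 0 T)), R s ≤ -c * E s + b + err s)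
    (hstart : E 0 + (b - c * ρ) * T ≤ 0) :
    E T ≤ ρ + b * T + ∫ s in (0 : ℝ)..T, err s := by
  have hle' : ∀ t ∈ Icc 0 T, ∀ᵐ s ∂(volume.restrict (Icc t T)), R s ≤ -c * E s + b + err s :=
    fun t ht => ae_mono (Measure.restrict_mono (Icc_subset_Icc_left ht.1) le_rfl) hle
  have herr' : ∀ t ∈ Icc 0 T, IntervalIntegrable err volume t T := fun t ht => by
    refine herr.mono_set ?_
    rw [uIcc_of_le ht.2, uIcc_of_le hT]
    exact Icc_subset_Icc_left ht.1
  have h0 : (0 : ℝ) ∈ Icc 0 T := ⟨le_rfl, hT⟩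
  have herrint : 0 ≤ ∫ s in (0 : ℝ)..T, err s :=
    intervalIntegral.integral_nonneg hT fun s _ => herr0 s
  by_cases hex : ∃ t ∈ Icc 0 T, E t ≤ ρ
  · obtain ⟨t, ht, hEt⟩ := hex
    obtain ⟨hRi, hR⟩ := hER t ht
    have h1 : ∫ s in t..T, R s ≤ ∫ s in t..T, (b + err s) := by
      refine intervalIntegral.integral_mono_ae_restrict ht.2 hRi
        (intervalIntegrable_const.add (herr' t ht)) ?_
      filter_upwards [hle' t ht] with s hs
      have := mul_nonneg hc (hE0 s)
      linarith
    rw [intervalIntegral.integral_add intervalIntegrable_const (herr' t ht),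
      intervalIntegral.integral_const, smul_eq_mul, hR] at h1
    have h2 : ∫ s in t..T, err s ≤ ∫ s in (0 : ℝ)..T, err s :=
      intervalIntegral.integral_mono_interval ht.1 ht.2 le_rfl
        (Eventually.of_forall herr0) herr
    have h3 : (T - t) * b ≤ b * T := by nlinarith [ht.1]
    linarith
  · push Not at hex
    obtain ⟨hRi, hR⟩ := hER 0 h0
    have h1 : ∫ s in (0 : ℝ)..T, R s ≤ ∫ s in (0 : ℝ)..T, ((b - c * ρ) + err s) := by
      refine intervalIntegral.integral_mono_ae_restrict hT hRi
        (intervalIntegrable_const.add herr) ?_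
      filter_upwards [hle, ae_restrict_mem measurableSet_Icc] with s hs hmem
      have := mul_le_mul_of_nonneg_left (hex s hmem).le hc
      linarith
    rw [intervalIntegral.integral_add intervalIntegrable_const herr,
      intervalIntegral.integral_const, smul_eq_mul, hR] at h1
    have h3 : 0 ≤ b * T := mul_nonneg hb hT
    have h4 : (T - 0) * (b - c * ρ) = (b - c * ρ) * T := by ring
    linarith

/-! ### Decay of the energy under small noise -/

/-- The temperature forcing `σ_θ l` as a trigonometric polynomial. -/
def noiseVal (Z : Finset (Fin 2 → ℤ)) (α l : NoiseIndex Z → ℝ) : C(Torus, ℝ) :=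
  noisePoly Z fun i => α i * l i

lemma exists_noise_bound (Z : Finset (Fin 2 → ℤ)) (α : NoiseIndex Z → ℝ) :
    ∃ K : ℝ, 0 ≤ K ∧ ∀ (l : NoiseIndex Z → ℝ) (δ : ℝ), (∀ i, |l i| ≤ δ) → 0 ≤ δ →
      (∀ x, |noiseVal Z α l x| ≤ K * δ) ∧ ‖toL2 (noiseVal Z α l)‖ ≤ K * δ ∧
      ‖toL2 (noisePoly Z fun i => waveSq i.1 * (α i * l i))‖ ≤ K * δ := by
  set S := ∑ i : NoiseIndex Z, (1 + waveSq i.1) * |α i| with hS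
  have hS0 : 0 ≤ S := Finset.sum_nonneg fun i _ =>
    mul_nonneg (by have := waveSq_nonneg i.1; linarith) (abs_nonneg _)
  have hK : S ≤ S * (1 + ‖toL2 1‖) := le_mul_of_one_le_right hS0 (by simp)
  have hK' : S * ‖toL2 1‖ ≤ S * (1 + ‖toL2 1‖) := by gcongr; simp
  refine ⟨S * (1 + ‖toL2 1‖), by positivity, fun l δ hl hδ => ?_⟩
  have b1 : ∀ x, |noiseVal Z α l x| ≤ S * δ := fun x => by
    refine (abs_noisePoly_le Z _ x).trans ?_
    rw [hS, Finset.sum_mul]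
    refine Finset.sum_le_sum fun i _ => ?_
    rw [abs_mul]
    refine mul_le_mul ?_ (hl i) (abs_nonneg _) (mul_nonneg ?_ (abs_nonneg _))
    · exact le_mul_of_one_le_left (abs_nonneg _) (by have := waveSq_nonneg i.1; linarith)
    · have := waveSq_nonneg i.1
      linarith
  have b2 : ∀ x, |noisePoly Z (fun i => waveSq i.1 * (α i * l i)) x| ≤ S * δ := fun x => by
    refine (abs_noisePoly_le Z _ x).trans ?_
    rw [hS, Finset.sum_mul]
    refine Finset.sum_le_sum fun i _ => ?_
    have hwi := waveSq_nonneg i.1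
    rw [abs_mul, abs_mul, abs_of_nonneg hwi, ← mul_assoc]
    refine mul_le_mul ?_ (hl i) (abs_nonneg _) (by positivity)
    gcongr
    linarith
  refine ⟨fun x => (b1 x).trans (by gcongr), (norm_toL2_le b1).trans ?_,
    (norm_toL2_le b2).trans ?_⟩ <;>
  · calc S * δ * ‖toL2 1‖ = S * ‖toL2 1‖ * δ := by ring
      _ ≤ _ := by gcongr

/-- The contribution of the Fourier tails outside `F` to the energy balance. Here `D` stands for
`‖∇w‖²`, and `τ` for the tail of the noise. -/
def tailErr (A B G D : ℝ) (w θ : L2) (τ : ℝ) (F : Finset (Fin 2 → ℤ)) : ℝ :=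
  D * (A * ‖w - proj F w‖ ^ 2 + B * (‖θ - proj F θ‖ + τ) ^ 2) + G * ‖w - proj F w‖

lemma measurable_norm_sub_proj {f : ℝ → L2} (hf : ∀ t, ContinuousWithinAt f (Ici t) t)
    (F : Finset (Fin 2 → ℤ)) : Measurable fun s => ‖f s - proj F (f s)‖ :=
  measurable_of_rightContinuous fun t => ((hf t).sub
    ((continuous_proj F).continuousAt.comp_continuousWithinAt (hf t))).norm

lemma tailErr_tendsto {A B G N : ℝ} (hA : 0 ≤ A) (hB : 0 ≤ B) (hG : 0 ≤ G) {D : ℝ → ℝ}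
    {w θ : ℝ → L2} {τ : Finset (Fin 2 → ℤ) → ℝ} {T : ℝ} (hT : 0 ≤ T)
    (hD0 : ∀ s, 0 ≤ D s) (hD : IntervalIntegrable D volume 0 T)
    (hw : ∀ t, ContinuousWithinAt w (Ici t) t) (hθ : ∀ t, ContinuousWithinAt θ (Ici t) t)
    (hN : ∀ s ≤ T, ‖w s‖ ≤ N ∧ ‖θ s‖ ≤ N) (hτ0 : ∀ F, 0 ≤ τ F) {τ₁ : ℝ} (hτ1 : ∀ F, τ F ≤ τ₁)
    (hτ : Tendsto τ atTop (𝓝 0)) :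
    (∀ F, IntervalIntegrable (fun s => tailErr A B G (D s) (w s) (θ s) (τ F) F) volume 0 T) ∧
    Tendsto (fun F => ∫ s in (0 : ℝ)..T, tailErr A B G (D s) (w s) (θ s) (τ F) F) atTop (𝓝 0) := by
  set bound : ℝ → ℝ := fun s => D s * (A * (2 * N) ^ 2 + B * (2 * N + τ₁) ^ 2) + G * (2 * N)
  have hbint : IntervalIntegrable bound volume 0 T :=
    (hD.mul_const _).add intervalIntegrable_const
  have hmeas : ∀ F, AEStronglyMeasurable (fun s => tailErr A B G (D s) (w s) (θ s) (τ F) F)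
      (volume.restrict (uIoc 0 T)) := fun F => by
    have hDm : AEStronglyMeasurable D (volume.restrict (uIoc 0 T)) := by
      rw [uIoc_of_le hT]
      exact hD.1.aestronglyMeasurable
    have m1 := measurable_norm_sub_proj hw F
    have m2 := measurable_norm_sub_proj hθ F
    refine (hDm.mul ?_).add ?_
    · exact (((m1.pow_const 2).const_mul A).add
        (((m2.add_const (τ F)).pow_const 2).const_mul B)).aestronglyMeasurable
    · exact (m1.const_mul G).aestronglyMeasurable
  have hle : ∀ F, ∀ s ∈ uIoc 0 T, ‖tailErr A B G (D s) (w s) (θ s) (τ F) F‖ ≤ bound s := fun F s hs => by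
    rw [uIoc_of_le hT] at hs
    obtain ⟨h1, h2⟩ := hN s hs.2
    have r1 := (norm_sub_proj_le F (w s)).trans (mul_le_mul_of_nonneg_left h1 zero_le_two)
    have r2 := (norm_sub_proj_le F (θ s)).trans (mul_le_mul_of_nonneg_left h2 zero_le_two)
    have hDs := hD0 s
    have hτF := hτ0 F
    have hτF1 := hτ1 F
    rw [Real.norm_of_nonneg (by unfold tailErr; positivity)]
    unfold tailErr
    simp only [bound]
    gcongr
  refine ⟨fun F => hbint.mono_fun (hmeas F) ?_, ?_⟩
  · filter_upwards [ae_restrict_mem measurableSet_uIoc] with s hs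
    exact (hle F s hs).trans (le_abs_self _)
  · have hlim := intervalIntegral.tendsto_integral_filter_of_dominated_convergence
      (F := fun F s => tailErr A B G (D s) (w s) (θ s) (τ F) F) (f := fun _ => (0 : ℝ)) (l := atTop) (μ := volume)
      (a := 0) (b := T) bound
      (Eventually.of_forall hmeas)
      (Eventually.of_forall fun F => Eventually.of_forall fun s hs => hle F s hs) hbint
      (Eventually.of_forall fun s _ => ?_)
    · simpa using hlim
    have htail : ∀ f : L2, Tendsto (fun F => ‖f - proj F f‖) atTop (𝓝 0) := fun f => by
      have := (tendsto_const_nhds (x := f)).sub (tendsto_proj f)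
      simpa using this.norm
    have t1 := htail (w s)
    have t2 := (htail (θ s)).add hτ
    have := ((((t1.pow 2).const_mul A).add ((t2.pow 2).const_mul B)).const_mul (D s)).add
      (t1.const_mul G)
    simpa [tailErr] using this

lemma modeEnergy_tendsto (ν₁ ν₂ g : ℝ) (w η : L2) :
    Tendsto (modeEnergy ν₁ ν₂ g w η) atTop
      (𝓝 (ν₁ * ν₂ / g ^ 2 * ‖w‖ ^ 2 + ‖η‖ ^ 2)) :=
  ((tendsto_frameSum_coef_sq w).const_mul _).add (tendsto_frameSum_coef_sq η)

/-- The energy of the modes in `F` is a primitive of twice `energyRate`. -/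
lemma IsPathSolution.exists_energy_balance {ν₁ ν₂ g : ℝ} (hν₁ : 0 < ν₁) (hν₂ : 0 < ν₂)
    {Z : Finset (Fin 2 → ℤ)} {α : NoiseIndex Z → ℝ} {L : ℝ≥0 → NoiseIndex Z → ℝ} {U₀ : H}
    {U : ℝ≥0 → H} (h : IsPathSolution ν₁ ν₂ g Z α L U₀ U) (T : ℝ≥0) :
    ∃ u : ℝ≥0 → Fin 2 → L2, (∀ t, IsBiotSavart (vort (U t)) (u t)) ∧
      (∀ t m, coef (temp (U t) - toL2 (noiseVal Z α (L t))) 0 m = 0) ∧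
      ∀ F : Finset (Fin 2 → ℤ), ∃ E R : ℝ → ℝ, (∀ s, 0 ≤ E s) ∧
        (∀ s : ℝ, 0 ≤ s → E s = modeEnergy ν₁ ν₂ g (vort (U s.toNNReal))
          (temp (U s.toNNReal) - toL2 (noiseVal Z α (L s.toNNReal))) F) ∧
        (∀ s : ℝ, 0 ≤ s → R s = 2 * energyRate ν₁ ν₂ g (U s.toNNReal) (u s.toNNReal)
          (noiseVal Z α (L s.toNNReal)) F) ∧
        (∀ t ∈ Icc (0 : ℝ) T, IntervalIntegrable R volume t T ∧
          ∫ s in t..T, R s = E T - E t) ∧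
        E 0 ≤ energyNorm ν₁ ν₂ g U₀ ^ 2 := by
  obtain ⟨u, hu, heq⟩ := h.equation
  have hlpos : 0 ≤ ν₁ * ν₂ / g ^ 2 := by positivity
  have hreg := h.drift_regular hu
  -- the coefficients of `w` and of `η = θ - q` are primitives of the drifts
  have hcw : ∀ k m, ∀ s : ℝ, 0 ≤ s → coef (vort (U s.toNNReal)) k m = coef (vort U₀) k m
      + ∫ r in (0 : ℝ)..s, vortDrift ν₁ g (U r.toNNReal) (u r.toNNReal) (trig k m) :=
    fun k m s hs => by
      have := (heq s.toNNReal (trig k m) (isSmooth_trig k m)).1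
      rw [Real.coe_toNNReal s hs] at this
      exact this
  have hcη : ∀ k m, ∀ s : ℝ, 0 ≤ s →
      coef (temp (U s.toNNReal) - toL2 (noiseVal Z α (L s.toNNReal))) k m = coef (temp U₀) k m
      + ∫ r in (0 : ℝ)..s, tempDrift ν₂ (U r.toNNReal) (u r.toNNReal) (trig k m) :=
    fun k m s hs => by
      have := (heq s.toNNReal (trig k m) (isSmooth_trig k m)).2
      rw [Real.coe_toNNReal s hs, forcing_trig] at this
      rw [coef_sub]
      exact sub_eq_of_eq_add this
  refine ⟨u, hu, fun t m => ?_, fun F => ?_⟩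
  · have h1 := hcη 0 m t t.coe_nonneg
    rw [Real.toNNReal_coe] at h1
    have h2 : coef (temp U₀) 0 m = 0 := coef_zero_of_mean_zero U₀.2.2 m
    rw [h1, h2]
    simp [tempDrift_trig, advect, tri, waveSq]
  generalize hdw : (fun (k : Fin 2 → ℤ) (m : Fin 2) (s : ℝ) =>
    vortDrift ν₁ g (U s.toNNReal) (u s.toNNReal) (trig k m)) = dw
  generalize hdθ : (fun (k : Fin 2 → ℤ) (m : Fin 2) (s : ℝ) =>
    tempDrift ν₂ (U s.toNNReal) (u s.toNNReal) (trig k m)) = dθ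
  have edw : ∀ k m s, vortDrift ν₁ g (U s.toNNReal) (u s.toNNReal) (trig k m) = dw k m s :=
    fun k m s => by rw [← hdw]
  have edθ : ∀ k m s, tempDrift ν₂ (U s.toNNReal) (u s.toNNReal) (trig k m) = dθ k m s :=
    fun k m s => by rw [← hdθ]
  simp only [edw, edθ] at hcw hcη hreg
  generalize ha0 : coef (vort U₀) = a₀ at hcw
  generalize hb0 : coef (temp U₀) = b₀ at hcη
  refine ⟨fun s => ν₁ * ν₂ / g ^ 2
        * frameSum F (fun k m => (a₀ k m + ∫ r in (0 : ℝ)..s, dw k m r) ^ 2)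
      + frameSum F (fun k m => (b₀ k m + ∫ r in (0 : ℝ)..s, dθ k m r) ^ 2),
    fun s => ν₁ * ν₂ / g ^ 2
        * frameSum F (fun k m => 2 * ((a₀ k m + ∫ r in (0 : ℝ)..s, dw k m r) * dw k m s))
      + frameSum F (fun k m => 2 * ((b₀ k m + ∫ r in (0 : ℝ)..s, dθ k m r) * dθ k m s)),
    fun s => ?_, fun s hs => ?_, fun s hs => ?_, fun t ht => ?_, ?_⟩
  · exact add_nonneg (mul_nonneg hlpos (frameSum_nonneg fun _ _ => sq_nonneg _))
      (frameSum_nonneg fun _ _ => sq_nonneg _)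
  · simp only [modeEnergy, hcw _ _ s hs, hcη _ _ s hs]
  · simp only [energyRate, hcw _ _ s hs, hcη _ _ s hs, edw, edθ, frameSum_mul_left]
    ring
  · have k1 := fun k m => integral_two_mul_primitive_mul (f₀ := a₀ k m) ht
      (hreg k m).1.1 ((hreg k m).1.2 T)
    have k2 := fun k m => integral_two_mul_primitive_mul (f₀ := b₀ k m) ht
      (hreg k m).2.1 ((hreg k m).2.2 T)
    obtain ⟨i1, e1⟩ := frameSum_integral F fun k m => (k1 k m).1
    obtain ⟨i2, e2⟩ := frameSum_integral F fun k m => (k2 k m).1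
    refine ⟨(i1.const_mul _).add i2, ?_⟩
    rw [intervalIntegral.integral_add (i1.const_mul _) i2, intervalIntegral.integral_const_mul,
      e1, e2]
    simp only [(k1 _ _).2, (k2 _ _).2, frameSum, Finset.sum_sub_distrib]
    ring
  · rw [energyNorm, Real.sq_sqrt (by positivity)]
    simp only [intervalIntegral.integral_same, add_zero, ← ha0, ← hb0]
    exact add_le_add (mul_le_mul_of_nonneg_left (frameSum_coef_sq_le F _) hlpos)
      (frameSum_coef_sq_le F _)

/-- The tails of the noise directions outside `F`. -/
def noiseTail (Z : Finset (Fin 2 → ℤ)) (α : NoiseIndex Z → ℝ) (F : Finset (Fin 2 → ℤ)) : ℝ :=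
  ∑ i : NoiseIndex Z, |α i| * ‖toL2 (trigC i.1 i.2) - proj F (toL2 (trigC i.1 i.2))‖

lemma noiseTail_nonneg (Z : Finset (Fin 2 → ℤ)) (α : NoiseIndex Z → ℝ)
    (F : Finset (Fin 2 → ℤ)) : 0 ≤ noiseTail Z α F :=
  Finset.sum_nonneg fun _ _ => by positivity

lemma noiseTail_le (Z : Finset (Fin 2 → ℤ)) (α : NoiseIndex Z → ℝ) (F : Finset (Fin 2 → ℤ)) :
    noiseTail Z α F ≤ ∑ i : NoiseIndex Z, |α i| * (2 * ‖toL2 (trigC i.1 i.2)‖) :=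
  Finset.sum_le_sum fun _ _ => mul_le_mul_of_nonneg_left (norm_sub_proj_le F _) (abs_nonneg _)

lemma noiseTail_tendsto (Z : Finset (Fin 2 → ℤ)) (α : NoiseIndex Z → ℝ) :
    Tendsto (noiseTail Z α) atTop (𝓝 0) := by
  have h1 : ∀ i : NoiseIndex Z, Tendsto (fun F =>
      |α i| * ‖toL2 (trigC i.1 i.2) - proj F (toL2 (trigC i.1 i.2))‖) atTop (𝓝 0) := fun i => by
    have := ((tendsto_const_nhds (x := toL2 (trigC i.1 i.2))).sub
      (tendsto_proj (toL2 (trigC i.1 i.2)))).norm.const_mul (|α i|)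
    simpa using this
  have h2 : Tendsto (noiseTail Z α) atTop (𝓝 (∑ _i : NoiseIndex Z, 0)) :=
    tendsto_finsetSum Finset.univ fun i _ => h1 i
  simpa using h2

/-- The tail of `η = θ - q` is controlled by the tails of `θ` and of the noise. -/
lemma norm_sub_noiseVal_tail_le (Z : Finset (Fin 2 → ℤ)) (α l : NoiseIndex Z → ℝ)
    (hl : ∀ i, |l i| ≤ 1) (θ : L2) (F : Finset (Fin 2 → ℤ)) :
    ‖(θ - toL2 (noiseVal Z α l)) - proj F (θ - toL2 (noiseVal Z α l))‖
      ≤ ‖θ - proj F θ‖ + noiseTail Z α F := by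
  have hq : ‖toL2 (noiseVal Z α l) - proj F (toL2 (noiseVal Z α l))‖ ≤ noiseTail Z α F := by
    refine norm_noisePoly_sub_proj_le Z _ (fun i => |α i|) (fun i => ?_) F
    rw [abs_mul]
    exact mul_le_of_le_one_right (abs_nonneg _) (hl i)
  generalize toL2 (noiseVal Z α l) = q at hq ⊢
  have e : proj F θ = proj F (θ - q) + proj F q := by rw [← proj_add, sub_add_cancel]
  calc ‖(θ - q) - proj F (θ - q)‖ = ‖(θ - proj F θ) - (q - proj F q)‖ := by
        rw [e]
        congr 1
        abel
    _ ≤ _ := norm_sub_le _ _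
    _ ≤ _ := by gcongr

/-- A bound of the energy at the time `T`, for a path of the noise of size at most `δ` up to that
time. -/
lemma IsPathSolution.energy_le {ν₁ ν₂ g : ℝ} (hν₁ : 0 < ν₁) (hν₂ : 0 < ν₂) (hg : g ≠ 0)
    {Z : Finset (Fin 2 → ℤ)} {α : NoiseIndex Z → ℝ} {L : ℝ≥0 → NoiseIndex Z → ℝ} {U₀ : H}
    {U : ℝ≥0 → H} (h : IsPathSolution ν₁ ν₂ g Z α L U₀ U) {T : ℝ≥0} {δ K ρ : ℝ} (hδ : 0 ≤ δ)
    (hδ1 : δ ≤ 1) (hL : ∀ t ≤ T, ∀ i, |L t i| ≤ δ) (hρ : 0 ≤ ρ)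
    (hK : ∀ (l : NoiseIndex Z → ℝ) (δ : ℝ), (∀ i, |l i| ≤ δ) → 0 ≤ δ →
      (∀ x, |noiseVal Z α l x| ≤ K * δ) ∧ ‖toL2 (noiseVal Z α l)‖ ≤ K * δ ∧
      ‖toL2 (noisePoly Z fun i => waveSq i.1 * (α i * l i))‖ ≤ K * δ)
    (hκ : 4 * (K * δ) ^ 2 / ν₂ ≤ ν₁ * ν₂ / g ^ 2 * ν₁ / 8)
    (hstart : energyNorm ν₁ ν₂ g U₀ ^ 2
      + (8 * ν₂ * (K * δ) ^ 2 - min ν₁ ν₂ / 4 * ρ) * T ≤ 0) :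
    ν₁ * ν₂ / g ^ 2 * ‖vort (U T)‖ ^ 2 + ‖temp (U T) - toL2 (noiseVal Z α (L T))‖ ^ 2
      ≤ ρ + 8 * ν₂ * (K * δ) ^ 2 * T := by
  obtain ⟨u, hu, hη0, hbal⟩ := h.exists_energy_balance hν₁ hν₂ T
  obtain ⟨Dw, Dθ, hDmem, hDae⟩ := h.sobolev T
  obtain ⟨N, hN⟩ := h.exists_bound T
  have hN0 : 0 ≤ N := (norm_nonneg _).trans (hN T le_rfl).1
  obtain ⟨Kv, hKv0, hKv⟩ := exists_velocity_bound
  have hlpos : 0 < ν₁ * ν₂ / g ^ 2 := by positivity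
  have hmin : 0 < min ν₁ ν₂ := lt_min hν₁ hν₂
  have hDint : IntervalIntegrable (fun s => ‖Dw 0 s‖ ^ 2 + ‖Dw 1 s‖ ^ 2) volume 0 T := by
    rw [intervalIntegrable_iff_integrableOn_Icc_of_le T.coe_nonneg]
    exact ((hDmem 0).1.integrable_norm_pow two_ne_zero).add
      ((hDmem 1).1.integrable_norm_pow two_ne_zero)
  obtain ⟨herrint, herrlim⟩ := tailErr_tendsto (A := 8 * (ν₁ * ν₂ / g ^ 2) / ν₁ * Kv ^ 2)
    (B := 8 / ν₂ * Kv ^ 2) (G := ν₁ * ν₂ / g ^ 2 * ν₁ / 4 * N) (by positivity) (by positivity)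
    (by positivity) T.coe_nonneg (fun s => by positivity) hDint
    (fun t => (h.vort_temp_right_cont t).1) (fun t => (h.vort_temp_right_cont t).2) hN
    (noiseTail_nonneg Z α) (noiseTail_le Z α) (noiseTail_tendsto Z α)
  have hlim := modeEnergy_tendsto ν₁ ν₂ g (vort (U T))
    (temp (U T) - toL2 (noiseVal Z α (L T)))
  have hlim2 := (tendsto_const_nhds (x := ρ + 8 * ν₂ * (K * δ) ^ 2 * T)).add herrlim
  refine (le_of_tendsto_of_tendsto' hlim hlim2 fun F => ?_).trans_eq (add_zero _)
  obtain ⟨E, R, hE0, hEmode, hRrate, hER, hEstart⟩ := hbal F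
  have hET := hEmode T T.coe_nonneg
  rw [Real.toNNReal_coe] at hET
  rw [← hET]
  refine energy_final_le (R := R) T.coe_nonneg (by positivity) (c := min ν₁ ν₂ / 4)
    (by positivity) hρ hE0 (fun s => ?_) hER (herrint F) ?_ (by linarith)
  · have := noiseTail_nonneg Z α F
    unfold tailErr
    positivity
  filter_upwards [hDae, ae_restrict_mem measurableSet_Icc] with s hDs hs
  have hLs : ∀ i, |L s.toNNReal i| ≤ δ := hL _ (Real.toNNReal_le_iff_le_coe.2 hs.2)
  obtain ⟨q1, q2, q3⟩ := hK _ δ hLs hδ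
  have hM := hKv (vort (U s.toNNReal)) (u s.toNNReal) (fun j => Dw j s)
    (hu s.toNNReal).fourier (fun j => (hDs j).1)
  have hw0 : ∀ m, coef (vort (U s.toNNReal)) 0 m = 0 :=
    fun m => coef_zero_of_mean_zero (U s.toNNReal).2.1 m
  have hrate := energyRate_le hν₁ hν₂ hg (hu s.toNNReal) hM q1 q2 q3
    (waveSq_mul_coef_noisePoly Z _) hw0 (hη0 s.toNNReal) hκ F
  rw [hRrate s hs.1, hEmode s hs.1]
  have htail := norm_sub_noiseVal_tail_le Z α (L s.toNNReal) (fun i => (hLs i).trans hδ1)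
    (temp (U s.toNNReal)) F
  have hwN := (hN s hs.2).1
  rw [tailErr]
  have hD0 : 0 ≤ ‖Dw 0 s‖ ^ 2 + ‖Dw 1 s‖ ^ 2 := by positivity
  have hτ0 := noiseTail_nonneg Z α F
  generalize ‖Dw 0 s‖ ^ 2 + ‖Dw 1 s‖ ^ 2 = D at hrate hD0 ⊢
  generalize modeEnergy ν₁ ν₂ g (vort (U s.toNNReal))
    (temp (U s.toNNReal) - toL2 (noiseVal Z α (L s.toNNReal))) F = e at hrate ⊢
  generalize energyRate ν₁ ν₂ g (U s.toNNReal) (u s.toNNReal)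
    (noiseVal Z α (L s.toNNReal)) F = r at hrate ⊢
  have hy0 : 0 ≤ ‖temp (U s.toNNReal) - toL2 (noiseVal Z α (L s.toNNReal))
    - proj F (temp (U s.toNNReal) - toL2 (noiseVal Z α (L s.toNNReal)))‖ := norm_nonneg _
  generalize ‖temp (U s.toNNReal) - toL2 (noiseVal Z α (L s.toNNReal))
    - proj F (temp (U s.toNNReal) - toL2 (noiseVal Z α (L s.toNNReal)))‖ = y at hrate htail hy0
  generalize ‖temp (U s.toNNReal) - proj F (temp (U s.toNNReal))‖ + noiseTail Z α F = y'
    at htail ⊢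
  have hx0 : 0 ≤ ‖vort (U s.toNNReal) - proj F (vort (U s.toNNReal))‖ := norm_nonneg _
  generalize ‖vort (U s.toNNReal) - proj F (vort (U s.toNNReal))‖ = x at hrate hx0 ⊢
  generalize ‖vort (U s.toNNReal)‖ = n at hrate hwN
  generalize ν₁ * ν₂ / g ^ 2 = lam at hrate hlpos ⊢
  have hsq : ∀ z, (Kv * Real.sqrt D * z) ^ 2 = Kv ^ 2 * D * z ^ 2 := fun z => by
    rw [mul_pow, mul_pow, Real.sq_sqrt hD0]
  rw [hsq, hsq] at hrate
  have t2 : 4 / ν₂ * (Kv ^ 2 * D * y ^ 2) ≤ 4 / ν₂ * (Kv ^ 2 * D * y' ^ 2) := by gcongr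
  have t3 : lam * ν₁ / 8 * (n * x) ≤ lam * ν₁ / 8 * (N * x) := by gcongr
  have t5 : D * (8 * lam / ν₁ * Kv ^ 2 * x ^ 2 + 8 / ν₂ * Kv ^ 2 * y' ^ 2)
      + lam * ν₁ / 4 * N * x = 2 * (4 * lam / ν₁ * (Kv ^ 2 * D * x ^ 2)
        + 4 / ν₂ * (Kv ^ 2 * D * y' ^ 2) + lam * ν₁ / 8 * (N * x)) := by ring
  rw [t5]
  linarith

/-- If the noise stays small up to the time `T`, then every solution started in the ball of radius `C`
is in the ball of radius `γ` at the time `T`. -/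
theorem exists_decay {ν₁ ν₂ g : ℝ} (hν₁ : 0 < ν₁) (hν₂ : 0 < ν₂) (hg : g ≠ 0)
    (Z : Finset (Fin 2 → ℤ)) (α : NoiseIndex Z → ℝ) {C γ : ℝ} (hC : 0 < C) (hγ : 0 < γ) :
    ∃ T : ℝ≥0, 0 < T ∧ ∃ δ : ℝ, 0 < δ ∧ ∀ (L : ℝ≥0 → NoiseIndex Z → ℝ) (U₀ : H) (U : ℝ≥0 → H),
      U₀ ∈ closedBallH ν₁ ν₂ g C → IsPathSolution ν₁ ν₂ g Z α L U₀ U →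
      (∀ t ≤ T, ∀ i, |L t i| ≤ δ) → U T ∈ closedBallH ν₁ ν₂ g γ := by
  obtain ⟨K, hK0, hK⟩ := exists_noise_bound Z α
  have hmin : 0 < min ν₁ ν₂ := lt_min hν₁ hν₂
  set c := min ν₁ ν₂ / 4 with hc
  have hcpos : 0 < c := by positivity
  set ρ := γ ^ 2 / 16 with hρ
  have hρpos : 0 < ρ := by positivity
  set T : ℝ≥0 := (2 * C ^ 2 / (c * ρ)).toNNReal with hT
  have hTval : (T : ℝ) = 2 * C ^ 2 / (c * ρ) := Real.coe_toNNReal _ (by positivity)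
  have hTpos : (0 : ℝ) < T := by rw [hTval]; positivity
  -- the noise level is chosen last: all conditions on it are open and hold for `δ = 0`
  have hsmall : ∀ (a b : ℝ), 0 < b → ∀ᶠ δ in 𝓝[>] (0 : ℝ), a * (K * δ) ^ 2 < b := fun a b hb => by
    have : Tendsto (fun δ : ℝ => a * (K * δ) ^ 2) (𝓝 0) (𝓝 (a * (K * 0) ^ 2)) :=
      (by fun_prop : Continuous fun δ : ℝ => a * (K * δ) ^ 2).tendsto 0
    refine (this.mono_left nhdsWithin_le_nhds).eventually (gt_mem_nhds ?_)
    simpa using hb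
  have hone : ∀ᶠ δ in 𝓝[>] (0 : ℝ), δ < 1 :=
    (tendsto_id.mono_left nhdsWithin_le_nhds).eventually (gt_mem_nhds one_pos)
  obtain ⟨δ, h1, h2, h3, h4, hδ1, hδ⟩ := ((hsmall (4 / ν₂) (ν₁ * ν₂ / g ^ 2 * ν₁ / 8)
    (by positivity)).and ((hsmall (8 * ν₂) (c * ρ / 2) (by positivity)).and
    ((hsmall (8 * ν₂ * T) ρ hρpos).and ((hsmall 1 (γ ^ 2 / 4) (by positivity)).and
    (hone.and self_mem_nhdsWithin))))).exists
  have hδpos : 0 < δ := hδ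
  refine ⟨T, by exact_mod_cast hTpos, δ, hδpos, fun L U₀ U hU₀ hU hL => ?_⟩
  have hE0 : energyNorm ν₁ ν₂ g U₀ ^ 2 ≤ C ^ 2 := pow_le_pow_left₀ (Real.sqrt_nonneg _) hU₀ 2
  have hstart : energyNorm ν₁ ν₂ g U₀ ^ 2 + (8 * ν₂ * (K * δ) ^ 2 - c * ρ) * T ≤ 0 := by
    have e : c * ρ / 2 * T = C ^ 2 := by
      rw [hTval]
      field_simp
    have h5 : (8 * ν₂ * (K * δ) ^ 2 - c * ρ) * T ≤ -(c * ρ / 2) * T :=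
      mul_le_mul_of_nonneg_right (by linarith) hTpos.le
    linarith
  have hκ : 4 * (K * δ) ^ 2 / ν₂ ≤ ν₁ * ν₂ / g ^ 2 * ν₁ / 8 := by
    refine le_trans (le_of_eq ?_) h1.le
    ring
  have hfin := hU.energy_le hν₁ hν₂ hg hδpos.le hδ1.le hL hρpos.le hK hκ hstart
  have hqT := (hK (L T) δ (hL T le_rfl) hδpos.le).2.1
  set η := temp (U T) - toL2 (noiseVal Z α (L T)) with hη
  have hθ : ‖temp (U T)‖ ≤ ‖η‖ + K * δ := by
    have : temp (U T) = η + toL2 (noiseVal Z α (L T)) := by rw [hη, sub_add_cancel]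
    rw [this]
    exact (norm_add_le _ _).trans (by gcongr)
  have hθ2 : ‖temp (U T)‖ ^ 2 ≤ 2 * ‖η‖ ^ 2 + 2 * (K * δ) ^ 2 := by
    have := pow_le_pow_left₀ (norm_nonneg _) hθ 2
    nlinarith [sq_nonneg (‖η‖ - K * δ)]
  have hw0 : 0 ≤ ν₁ * ν₂ / g ^ 2 * ‖vort (U T)‖ ^ 2 := by positivity
  have hb : 8 * ν₂ * (K * δ) ^ 2 * T ≤ ρ := by linarith
  change energyNorm ν₁ ν₂ g (U T) ≤ γ
  rw [energyNorm]
  refine Real.sqrt_le_iff.2 ⟨hγ.le, ?_⟩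
  linarith

/-! ### The noise is small with positive probability -/

/-- The Laplace exponent of a driftless subordinator is sublinear. -/
lemma tendsto_laplaceExponent_div {νS : Measure ℝ}
    (hνS : ∫⁻ r in Ioi (0 : ℝ), ENNReal.ofReal (min 1 r) ∂νS < ∞) :
    Tendsto (fun n : ℕ => (∫ r in Ioi (0 : ℝ), (1 - Real.exp (-((n : ℝ) + 1) * r)) ∂νS)
      / ((n : ℝ) + 1)) atTop (𝓝 0) := by
  have hint : Integrable (fun r : ℝ => min 1 r) (νS.restrict (Ioi 0)) := by
    refine (lintegral_ofReal_ne_top_iff_integrable (by fun_prop) ?_).1 hνS.ne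
    filter_upwards [ae_restrict_mem measurableSet_Ioi] with r hr
    exact le_min zero_le_one (le_of_lt hr)
  have h := tendsto_integral_of_dominated_convergence (μ := νS.restrict (Ioi 0))
    (F := fun (n : ℕ) r => (1 - Real.exp (-((n : ℝ) + 1) * r)) / ((n : ℝ) + 1))
    (f := fun _ => (0 : ℝ)) (fun r => min 1 r)
    (fun n => by fun_prop) hint (fun n => ?_) ?_
  · simpa [integral_div] using h
  · filter_upwards [ae_restrict_mem measurableSet_Ioi] with r hr
    have hr0 : (0 : ℝ) < r := hr
    have hn : (0 : ℝ) < (n : ℝ) + 1 := by positivity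
    have h1 : Real.exp (-((n : ℝ) + 1) * r) ≤ 1 := Real.exp_le_one_iff.2 (by nlinarith)
    rw [Real.norm_of_nonneg (div_nonneg (by linarith) hn.le), div_le_iff₀ hn]
    have h2 := Real.add_one_le_exp (-((n : ℝ) + 1) * r)
    have h3 := Real.exp_pos (-((n : ℝ) + 1) * r)
    have hn1 : (1 : ℝ) ≤ (n : ℝ) + 1 := by
      have : (0 : ℝ) ≤ n := n.cast_nonneg
      linarith
    rcases le_total 1 r with h | h
    · rw [min_eq_left h]
      linarith
    · rw [min_eq_right h]
      linarith
  · filter_upwards [ae_restrict_mem measurableSet_Ioi] with r hr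
    have hr0 : (0 : ℝ) < r := hr
    refine squeeze_zero (g := fun n : ℕ => 1 / ((n : ℝ) + 1)) (fun n => ?_) (fun n => ?_)
      tendsto_one_div_add_atTop_nhds_zero_nat
    · have hn : (0 : ℝ) < (n : ℝ) + 1 := by positivity
      have h1 : Real.exp (-((n : ℝ) + 1) * r) ≤ 1 := Real.exp_le_one_iff.2 (by nlinarith)
      exact div_nonneg (by linarith) hn.le
    · have h3 := Real.exp_pos (-((n : ℝ) + 1) * r)
      gcongr
      linarith

/-- A driftless subordinator stays below any positive level with positive probability: otherwise its
Laplace exponent would grow linearly. -/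
lemma IsPureJumpSubordinator.measure_le_pos {Ω : Type*} [MeasurableSpace Ω] {P : Measure Ω}
    [IsProbabilityMeasure P] {S : ℝ≥0 → Ω → ℝ≥0} {νS : Measure ℝ}
    (hS : IsPureJumpSubordinator S νS P)
    (hνS : ∫⁻ r in Ioi (0 : ℝ), ENNReal.ofReal (min 1 r) ∂νS < ∞) (T : ℝ≥0) {ε : ℝ≥0}
    (hε : 0 < ε) : 0 < P {ω | S T ω ≤ ε} := by
  refine pos_iff_ne_zero.2 fun h0 => ?_
  have hae : ∀ᵐ ω ∂P, ε < S T ω := by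
    rw [ae_iff]
    simpa only [not_lt] using h0
  have hle : ∀ n : ℕ, (ε : ℝ) ≤ T * ((∫ r in Ioi (0 : ℝ), (1 - Real.exp (-((n : ℝ) + 1) * r)) ∂νS)
      / ((n : ℝ) + 1)) := fun n => by
    have hn : (0 : ℝ) < (n : ℝ) + 1 := by positivity
    have hL := hS.laplace 0 T zero_le ((n : ℝ) + 1) hn.le
    have h1 : ∫ ω, Real.exp (-((n : ℝ) + 1) * ((S T ω : ℝ) - S 0 ω)) ∂P
        ≤ ∫ _ω, Real.exp (-((n : ℝ) + 1) * ε) ∂P := by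
      refine integral_mono_of_nonneg (Eventually.of_forall fun _ => (Real.exp_pos _).le)
        (integrable_const _) ?_
      filter_upwards [hae, hS.start] with ω h2 h3
      have h4 : (ε : ℝ) < S T ω := by exact_mod_cast h2
      rw [h3, NNReal.coe_zero, sub_zero]
      refine Real.exp_le_exp.2 ?_
      nlinarith
    rw [hL, integral_const, probReal_univ, one_smul, Real.exp_le_exp] at h1
    rw [← mul_div_assoc, le_div_iff₀ hn]
    simp only [NNReal.coe_zero, sub_zero] at h1
    linarith
  have hlim := (tendsto_laplaceExponent_div hνS).const_mul (T : ℝ)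
  rw [mul_zero] at hlim
  have := ge_of_tendsto' hlim hle
  have hε' : (0 : ℝ) < ε := by exact_mod_cast hε
  linarith

/-- The paths indexed by `ι` that are bounded by `δ` at the points of a countable dense set of times
before `ε`; unlike a bound at all times, this is a measurable condition. -/
def smallPaths (ι : Type*) (δ : ℝ) (ε : ℝ≥0) : Set (ι → ℝ≥0 → ℝ) :=
  {f | ∀ i k, TopologicalSpace.denseSeq ℝ≥0 k < ε → |f i (TopologicalSpace.denseSeq ℝ≥0 k)| ≤ δ}

lemma measurableSet_smallPaths (ι : Type*) [Countable ι] (δ : ℝ) (ε : ℝ≥0) :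
    MeasurableSet (smallPaths ι δ ε) := by
  have h : smallPaths ι δ ε = ⋂ (i : ι) (k : ℕ) (_ : TopologicalSpace.denseSeq ℝ≥0 k < ε),
      {f : ι → ℝ≥0 → ℝ | |f i (TopologicalSpace.denseSeq ℝ≥0 k)| ≤ δ} := by
    ext f
    simp [smallPaths]
  rw [h]
  refine MeasurableSet.iInter fun i => MeasurableSet.iInter fun k => MeasurableSet.iInter fun _ => ?_
  refine measurableSet_le ?_ measurable_const
  exact ((measurable_pi_apply _).comp (measurable_pi_apply i)).abs

lemma abs_le_of_mem_smallPaths {ι : Type*} {δ : ℝ} {ε : ℝ≥0} {f : ι → ℝ≥0 → ℝ}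
    (hf : f ∈ smallPaths ι δ ε) {i : ι} (hc : Continuous (f i)) {s : ℝ≥0} (hs : s < ε) :
    |f i s| ≤ δ := by
  have hcl : IsClosed {t | |f i t| ≤ δ} := isClosed_le hc.abs continuous_const
  have hsub : Iio ε ∩ range (TopologicalSpace.denseSeq ℝ≥0) ⊆ {t | |f i t| ≤ δ} := by
    rintro _ ⟨ht, k, rfl⟩
    exact hf i k ht
  have h1 := (TopologicalSpace.denseRange_denseSeq ℝ≥0).open_subset_closure_inter
    (isOpen_Iio (a := ε)) hs
  exact hcl.closure_subset_iff.2 hsub h1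

lemma IsBrownianFamily.exists_smallPaths_pos {Ω ι : Type*} [Finite ι] [MeasurableSpace Ω]
    {P : Measure Ω} [IsProbabilityMeasure P] {W : ι → ℝ≥0 → Ω → ℝ} (hW : IsBrownianFamily W P)
    {δ : ℝ} (hδ : 0 < δ) :
    ∃ ε : ℝ≥0, 0 < ε ∧ 0 < P ((fun ω i t => W i t ω) ⁻¹' smallPaths ι δ ε) := by
  by_contra! hcon
  have hzero : ∀ n : ℕ, P ((fun ω i t => W i t ω) ⁻¹' smallPaths ι δ (1 / ((n : ℝ≥0) + 1))) = 0 :=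
    fun n => le_antisymm (hcon _ (by positivity)) zero_le
  have hall : ∀ᵐ ω ∂P, ∀ i, Tendsto (W i · ω) (𝓝 0) (𝓝 0) :=
    ae_all_iff.2 fun i => (hW.brownian i).tendsto_nhds_zero
  have hmem : ∀ᵐ ω ∂P, ω ∈ ⋃ n : ℕ,
      (fun ω i t => W i t ω) ⁻¹' smallPaths ι δ (1 / ((n : ℝ≥0) + 1)) := by
    filter_upwards [hall] with ω hω
    have h1 : ∀ᶠ t in 𝓝 (0 : ℝ≥0), ∀ i, |W i t ω| ≤ δ := by
      refine eventually_all.2 fun i => ?_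
      have h2 : Tendsto (fun t => |W i t ω|) (𝓝 0) (𝓝 0) := by simpa using (hω i).abs
      exact (h2.eventually (gt_mem_nhds hδ)).mono fun _ h => h.le
    obtain ⟨η, hη, hball⟩ := Metric.eventually_nhds_iff.1 h1
    obtain ⟨n, hn⟩ := exists_nat_one_div_lt hη
    refine mem_iUnion.2 ⟨n, fun i k hk => hball ?_ i⟩
    have hk' : ((TopologicalSpace.denseSeq ℝ≥0 k : ℝ≥0) : ℝ) < 1 / ((n : ℝ) + 1) := by
      exact_mod_cast hk
    rw [NNReal.dist_eq, NNReal.coe_zero, sub_zero, abs_of_nonneg (NNReal.coe_nonneg _)]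
    exact hk'.trans hn
  have hU : P (⋃ n : ℕ, (fun ω i t => W i t ω) ⁻¹' smallPaths ι δ (1 / ((n : ℝ≥0) + 1))) = 0 :=
    measure_iUnion_null hzero
  obtain ⟨ω, h1, h2⟩ := (hmem.and (measure_eq_zero_iff_ae_notMem.1 hU)).exists
  exact h2 h1

/-- With positive probability the subordinated Brownian motion stays small up to a given time: the
subordinator stays below a level up to which the Brownian motion is small, and the two are
independent. -/
lemma exists_small_noise_event {Ω ι : Type*} [Finite ι] [MeasurableSpace Ω] {P : Measure Ω}
    [IsProbabilityMeasure P] {νS : Measure ℝ}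
    (hνS : ∫⁻ r in Ioi (0 : ℝ), ENNReal.ofReal (min 1 r) ∂νS < ∞)
    {W : ι → ℝ≥0 → Ω → ℝ} (hW : IsBrownianFamily W P)
    {S : ℝ≥0 → Ω → ℝ≥0} (hS : IsPureJumpSubordinator S νS P)
    (hWS : IndepFun (fun ω (i : ι) (t : ℝ≥0) => W i t ω) (fun ω (t : ℝ≥0) => S t ω) P)
    (T : ℝ≥0) {δ : ℝ} (hδ : 0 < δ) :
    ∃ A : Set Ω, 0 < P A ∧ ∀ᵐ ω ∂P, ω ∈ A → ∀ t ≤ T, ∀ i, |W i (S t ω) ω| ≤ δ := by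
  obtain ⟨ε, hε, hWpos⟩ := hW.exists_smallPaths_pos hδ
  have hSpos : 0 < P {ω | S T ω ≤ ε / 2} := hS.measure_le_pos hνS T (half_pos hε)
  have hind := hWS.measure_inter_preimage_eq_mul _ {s : ℝ≥0 → ℝ≥0 | s T ≤ ε / 2}
    (measurableSet_smallPaths ι δ ε)
    (measurableSet_le (measurable_pi_apply T) measurable_const)
  refine ⟨(fun ω i t => W i t ω) ⁻¹' smallPaths ι δ ε
      ∩ (fun ω t => S t ω) ⁻¹' {s : ℝ≥0 → ℝ≥0 | s T ≤ ε / 2}, ?_, ?_⟩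
  · rw [hind]
    exact ENNReal.mul_pos hWpos.ne' hSpos.ne'
  have hcont : ∀ᵐ ω ∂P, ∀ i, Continuous (W i · ω) :=
    ae_all_iff.2 fun i => (hW.brownian i).cont
  filter_upwards [hcont, hS.mono] with ω hc hmono hmem t ht i
  -- the subordinator is increasing, so that up to the time `T` it only sees `W` on `[0, ε / 2]`
  exact abs_le_of_mem_smallPaths (f := fun i t => W i t ω) hmem.1 (hc i)
    (((hmono ht).trans hmem.2).trans_lt (half_lt_self hε))

end Boussinesq

end

theorem proposition5p6 {Ω : Type*} [MeasurableSpace Ω] (P : Measure Ω) [IsProbabilityMeasure P]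
    (ν₁ ν₂ g : ℝ) (hν₁ : 0 < ν₁) (hν₂ : 0 < ν₂) (hg : g ≠ 0)
    (Z : Finset (Fin 2 → ℤ)) (hZ : ∀ k ∈ Z, k ≠ 0) (α : NoiseIndex Z → ℝ)
    (νS : Measure ℝ) (hνS : ∫⁻ r in Ioi (0 : ℝ), ENNReal.ofReal (min 1 r) ∂νS < ∞)
    (W : NoiseIndex Z → ℝ≥0 → Ω → ℝ) (hW : IsBrownianFamily W P)
    (S : ℝ≥0 → Ω → ℝ≥0) (hS : IsPureJumpSubordinator S νS P)
    (hWS : IndepFun (fun ω (i : NoiseIndex Z) (t : ℝ≥0) => W i t ω) (fun ω (t : ℝ≥0) => S t ω) P)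
    (C γ : ℝ) (hC : 0 < C) (hγ : 0 < γ) :
    ∃ T : ℝ≥0, 0 < T ∧
      0 < ⨅ (U₀ : H) (_ : U₀ ∈ closedBallH ν₁ ν₂ g C) (U : ℝ≥0 → Ω → H)
        (_ : IsSolution P ν₁ ν₂ g Z α W S U₀ U),
          P {ω | U T ω ∈ closedBallH ν₁ ν₂ g γ} := by
  obtain ⟨T, hT, δ, hδ, hdecay⟩ := exists_decay hν₁ hν₂ hg Z α hC hγ
  obtain ⟨A, hA, hsmall⟩ := exists_small_noise_event hνS hW hS hWS T hδ
  refine ⟨T, hT, hA.trans_le ?_⟩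
  refine le_iInf fun U₀ => le_iInf fun hU₀ => le_iInf fun U => le_iInf fun hU => measure_mono_ae ?_
  exact (hU.path.and hsmall).mono fun ω hω hmem =>
    hdecay (fun t i => W i (S t ω) ω) U₀ (fun t => U t ω) hU₀ hω.1 (hω.2 hmem)
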